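/- Let $d\ge 2$, $n\ge 1$, $Q=[0,1]^d$, and let $\mathbb K=\mathbb R$ or $\mathbb C$. All functions of $y$ are $Q$-periodic (subscript $\#$) and $\mathbb K$-valued unless stated otherwise; coefficients are real. Let $\rho\in L^\infty_\#(Q)$ with $\rho\ge\nu>0$ a.e., and let $a^{(1)},a^{(0)}\in (L^\infty_\#(Q))^{n\times d\times n\times d}$ satisfy, for a.e. $y$: $a^{(l)}_{ijpq}=a^{(l)}_{pqij}$; $a^{(1)}_{ijpq}\zeta_{ij}\zeta_{pq}\ge 0$ and $(a^{(0)}_{ijpq}+a^{(1)}_{ijpq})\zeta_{ij}\zeta_{pq}\ge A^{(0)}_{ijpq}\zeta_{ij}\zeta_{pq}$ for all $\zeta\in\mathbb R^{n\times d}$, where $A^{(0)}$ is a constant tensor with $A^{(0)}_{ijpq}\xi_i\eta_j\xi_p\eta_q\ge\nu|\xi|^2|\eta|^2$ for all $\xi\in\mathbb R^n$, $\eta\in\mathbb R^d$ (summation over repeated indices). Put $$V=\{v\in (H^1_\#(Q))^n:\ a^{(1)}\nabla_y v=0\},\qquad W=\{\psi\in (L^2_\#(Q))^{n\times d}:\ \mathrm{div}_y\big((a^{(1)})^{1/2}\psi\big)=0\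 \text{in}\ (H^{-1}_\#(Q))^n\},$$ with the $H^1$ and $L^2$ norms respectively. For an open set $\Omega\subset\mathbb R^d$ let $U$ be the space of all $u\in L^2(\Omega;V)$ for which there is $\xi\in L^2(\Omega;W)$ such that $$\int_\Omega\int_Q \xi\cdot\overline{\Psi}\,dy\,dx=-\int_\Omega\int_Q u\cdot\overline{\mathrm{div}_x\big((a^{(1)}(y))^{1/2}\Psi(x,y)\big)}\,dy\,dx$$ for every $\Psi$ that is the restriction to $\Omega$ of a function in $C_0^\infty(\mathbb R^d;W)$ (such $\Psi$ need not vanish on $\partial\Omega$). This $\xi$ is unique; write $Tu=\xi$. For $u,w\in U$ let $$\mathcal Q(u,w)=\int_\Omega\int_Q\Big\{Tu\cdot\overline{Tw}+a^{(0)}(y)\nabla_y u\cdot\overline{\nabla_y w}+\rho(y)\,u\cdot\overline{w}\Big\}\,dy\,dx,\qquad \|u\|_U=\mathcal Q(u,u)^{1/2}.$$ Lemma. Let $\Omega=\mathbb R^d$, or let $\Omega$ be a strictly star-shaped domain, i.e. $\Omega$ is open and there is $x_0\in\Omega$ such that $x_0+t(x-x_0)\in\Omega$ for all $x\in\overline\Omega$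 and $0\le t<1$. Then $U$ is the closure of $C_0^\infty(\Omega;V)$ in the norm $\|\cdot\|_U$: $C_0^\infty(\Omega;V)\subset U$, and for every $u\in U$ and $\varepsilon>0$ there is $\varphi\in C_0^\infty(\Omega;V)$ with $\|u-\varphi\|_U<\varepsilon$. -/

import Mathlib

open MeasureTheory Filter Topology
open scoped ContDiff ENNReal Matrix

namespace TwoScale

noncomputable section

/-! ### The periodicity cell and functions on it

A `Q`-periodic function is determined by its values on the cell `Q = [0,1]^d`, so `L²_#(Q)` and
`L^∞_#(Q)` are the Lebesgue spaces of `Q`. Periodicity enters through the test functions of the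
weak gradient below. -/

/-- The Euclidean space `ℝ^d`. -/
abbrev Space (d : ℕ) := EuclideanSpace ℝ (Fin d)

/-- The periodicity cell `Q = [0,1]^d`. -/
def cell (d : ℕ) : Set (Space d) := {y | ∀ j, y j ∈ Set.Icc (0 : ℝ) 1}

/-- Lebesgue measure on the periodicity cell. -/
abbrev cellMeasure (d : ℕ) : Measure (Space d) := volume.restrict (cell d)

/-- `L²_#(Q)` with values in `𝕜^ι`. -/
abbrev L2Q (𝕜 : Type*) [RCLike 𝕜] (d : ℕ) (ι : Type*) [Fintype ι] :=
  Lp (EuclideanSpace 𝕜 ι) 2 (cellMeasure d)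

/-- `(L²_#(Q))^n × (L²_#(Q))^{n×d}` as a Hilbert space, with norm `(‖v‖² + ‖g‖²)^{1/2}`. -/
abbrev PairL2 (𝕜 : Type*) [RCLike 𝕜] (d n : ℕ) :=
  WithLp 2 (L2Q 𝕜 d (Fin n) × L2Q 𝕜 d (Fin n × Fin d))

/-- A smooth real function on `ℝ^d` with period `1` in every coordinate. -/
def IsPeriodicTest {d : ℕ} (θ : Space d → ℝ) : Prop :=
  ContDiff ℝ ∞ θ ∧ ∀ (y : Space d) (j : Fin d), θ (y + EuclideanSpace.single j 1) = θ y

/-- `g` is the weak gradient on the torus of the periodic field `v`, `g_{ij} = ∂v_i/∂y_j`. -/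
def IsWeakGrad {𝕜 : Type*} [RCLike 𝕜] {d n : ℕ} (v : L2Q 𝕜 d (Fin n))
    (g : L2Q 𝕜 d (Fin n × Fin d)) : Prop :=
  ∀ θ : Space d → ℝ, IsPeriodicTest θ → ∀ (i : Fin n) (j : Fin d),
    ∫ y in cell d, fderiv ℝ θ y (EuclideanSpace.single j 1) • v y i =
      - ∫ y in cell d, θ y • g y (i, j)

lemma isCompact_cell (d : ℕ) : IsCompact (cell d) := by
  have h : cell d = (EuclideanSpace.equiv (Fin d) ℝ) ⁻¹' (Set.Icc 0 1) := by
    ext y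
    simp [cell, Set.mem_Icc, Pi.le_def, forall_and]
  rw [h]
  exact (EuclideanSpace.equiv (Fin d) ℝ).toHomeomorph.isCompact_preimage.2 isCompact_Icc

instance (d : ℕ) : IsFiniteMeasure (cellMeasure d) :=
  ⟨by simpa using (isCompact_cell d).measure_lt_top⟩

lemma integrable_smul_coord {𝕜 : Type*} [RCLike 𝕜] {d : ℕ} {ι : Type*} [Fintype ι]
    (v : L2Q 𝕜 d ι) {θ : Space d → ℝ} (hθ : Continuous θ) (i : ι) :
    Integrable (fun y => θ y • v y i) (cellMeasure d) := by
  have h : IntegrableOn (fun y => v y i) (cell d) :=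
    ((Lp.memLp v).eval_piLp i).integrable (by norm_num)
  exact h.continuousOn_smul hθ.continuousOn (isCompact_cell d)

lemma continuous_fderiv_apply {d : ℕ} {θ : Space d → ℝ} (hθ : ContDiff ℝ ∞ θ) (e : Space d) :
    Continuous (fun y => fderiv ℝ θ y e) :=
  (hθ.continuous_fderiv (by simp)).clm_apply continuous_const

/-- `(H¹_#(Q))^n`, realised as the set of pairs `(v, ∇_y v)`; the inherited norm is the
`H¹` norm `(‖v‖² + ‖∇_y v‖²)^{1/2}`. -/
def H1per (𝕜 : Type*) [RCLike 𝕜] (d n : ℕ) : Submodule 𝕜 (PairL2 𝕜 d n) where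
  carrier := {p | IsWeakGrad p.fst p.snd}
  zero_mem' := by
    intro θ hθ i j
    have h1 := Lp.coeFn_zero (EuclideanSpace 𝕜 (Fin n)) 2 (cellMeasure d)
    have h2 := Lp.coeFn_zero (EuclideanSpace 𝕜 (Fin n × Fin d)) 2 (cellMeasure d)
    rw [WithLp.zero_fst, WithLp.zero_snd,
      integral_eq_zero_of_ae
        (h1.mono fun y hy => by simp only [hy, Pi.zero_apply, PiLp.zero_apply, smul_zero]),
      integral_eq_zero_of_ae
        (h2.mono fun y hy => by simp only [hy, Pi.zero_apply, PiLp.zero_apply, smul_zero]),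
      neg_zero]
  add_mem' := by
    intro p q hp hq θ hθ i j
    have h1 := Lp.coeFn_add p.fst q.fst
    have h2 := Lp.coeFn_add p.snd q.snd
    have e1 := integral_add (integrable_smul_coord p.fst (continuous_fderiv_apply hθ.1
      (EuclideanSpace.single j 1)) i) (integrable_smul_coord q.fst (continuous_fderiv_apply hθ.1
      (EuclideanSpace.single j 1)) i)
    have e2 := integral_add (integrable_smul_coord p.snd hθ.1.continuous (i, j))
      (integrable_smul_coord q.snd hθ.1.continuous (i, j))
    rw [hp θ hθ i j, hq θ hθ i j] at e1
    rw [WithLp.add_fst, WithLp.add_snd]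
    refine (integral_congr_ae (h1.mono fun y hy => ?_)).trans (e1.trans ?_)
    · simp only [hy, Pi.add_apply, PiLp.add_apply, smul_add]
    · rw [← neg_add, ← e2, neg_inj]
      refine integral_congr_ae (h2.mono fun y hy => ?_)
      simp only [hy, Pi.add_apply, PiLp.add_apply, smul_add]
  smul_mem' := by
    intro c p hp θ hθ i j
    have h1 := Lp.coeFn_smul c p.fst
    have h2 := Lp.coeFn_smul c p.snd
    have hp' := hp θ hθ i j
    rw [WithLp.smul_fst, WithLp.smul_snd]
    refine (integral_congr_ae (g := fun y => c • (fderiv ℝ θ y (EuclideanSpace.single j 1) •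
      p.fst y i)) (h1.mono fun y hy => ?_)).trans ?_
    · simp only [hy, Pi.smul_apply, PiLp.smul_apply, smul_comm c]
    · rw [integral_smul, hp', smul_neg, neg_inj, ← integral_smul]
      refine integral_congr_ae (h2.mono fun y hy => ?_)
      simp only [hy, Pi.smul_apply, PiLp.smul_apply, smul_comm c]

/-! ### Multiplication by bounded coefficients -/

/-- The entries of the matrix field `m` belong to `L^∞_#(Q)`. -/
def IsLinfty {d : ℕ} {ι : Type*} (m : Space d → Matrix ι ι ℝ) : Prop :=
  ∀ k l, MemLp (fun y => m y k l) ∞ (cellMeasure d)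

/-- The pointwise product `y ↦ m(y) f(y)`. -/
def mulFun {𝕜 : Type*} [RCLike 𝕜] {d : ℕ} {ι : Type*} [Fintype ι]
    (m : Space d → Matrix ι ι ℝ) (f : Space d → EuclideanSpace 𝕜 ι) :
    Space d → EuclideanSpace 𝕜 ι :=
  fun y => WithLp.toLp 2 fun k => ∑ l, m y k l • f y l

lemma IsLinfty.exists_bound {d : ℕ} {ι : Type*} [Fintype ι]
    {m : Space d → Matrix ι ι ℝ} (hm : IsLinfty m) :
    ∃ C : ℝ, 0 ≤ C ∧ ∀ᵐ y ∂(cellMeasure d), ∀ k l, |m y k l| ≤ C := by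
  have h : ∀ k l, ∀ᵐ y ∂(cellMeasure d), ‖m y k l‖ ≤
      lpNorm (fun y => m y k l) ∞ (cellMeasure d) := fun k l => ae_le_lpNorm_exponent_top (hm k l)
  refine ⟨∑ k, ∑ l, lpNorm (fun y => m y k l) ∞ (cellMeasure d),
    Finset.sum_nonneg fun _ _ => Finset.sum_nonneg fun _ _ => lpNorm_nonneg, ?_⟩
  have h' := ae_all_iff.2 fun k => ae_all_iff.2 (h k)
  filter_upwards [h'] with y hy k l
  refine (hy k l).trans ?_
  refine le_trans ?_ (Finset.single_le_sum (f := fun k => ∑ l, lpNorm (fun y => m y k l) ∞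
    (cellMeasure d)) (fun _ _ => Finset.sum_nonneg fun _ _ => lpNorm_nonneg) (Finset.mem_univ k))
  exact Finset.single_le_sum (f := fun l => lpNorm (fun y => m y k l) ∞ (cellMeasure d))
    (fun _ _ => lpNorm_nonneg) (Finset.mem_univ l)

lemma norm_mulFun_le {𝕜 : Type*} [RCLike 𝕜] {d : ℕ} {ι : Type*} [Fintype ι]
    {m : Space d → Matrix ι ι ℝ} {C : ℝ} (hC : 0 ≤ C) {y : Space d} (hy : ∀ k l, |m y k l| ≤ C)
    (f : Space d → EuclideanSpace 𝕜 ι) :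
    ‖mulFun m f y‖ ≤ (Fintype.card ι * (Fintype.card ι * C)) * ‖f y‖ := by
  have h1 : ‖mulFun m f y‖ ≤ ∑ k, ‖mulFun m f y k‖ := by
    classical
    have e : mulFun m f y = ∑ k, EuclideanSpace.single k (mulFun m f y k) := by
      ext k
      simp [Finset.sum_apply, Pi.single_apply]
    calc ‖mulFun m f y‖ = ‖∑ k, EuclideanSpace.single k (mulFun m f y k)‖ := by rw [← e]
      _ ≤ ∑ k, ‖EuclideanSpace.single k (mulFun m f y k)‖ := norm_sum_le _ _
      _ = _ := by simp
  have h2 : ∀ k, ‖mulFun m f y k‖ ≤ Fintype.card ι * C * ‖f y‖ := by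
    intro k
    calc ‖mulFun m f y k‖ = ‖∑ l, m y k l • f y l‖ := rfl
      _ ≤ ∑ l, ‖m y k l • f y l‖ := norm_sum_le _ _
      _ ≤ ∑ _l : ι, C * ‖f y‖ := Finset.sum_le_sum fun l _ => by
          rw [norm_smul]
          exact mul_le_mul (hy k l) (PiLp.norm_apply_le _ _) (norm_nonneg _) hC
      _ = _ := by simp [mul_assoc]
  calc ‖mulFun m f y‖ ≤ ∑ k, ‖mulFun m f y k‖ := h1
    _ ≤ ∑ _k : ι, Fintype.card ι * C * ‖f y‖ := Finset.sum_le_sum fun k _ => h2 k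
    _ = _ := by simp [mul_assoc]

lemma IsLinfty.memLp_mulFun {𝕜 : Type*} [RCLike 𝕜] {d : ℕ} {ι : Type*} [Fintype ι]
    {m : Space d → Matrix ι ι ℝ} (hm : IsLinfty m) (f : L2Q 𝕜 d ι) :
    MemLp (mulFun m f) 2 (cellMeasure d) := by
  refine MemLp.of_eval_piLp fun k => ?_
  refine memLp_finsetSum _ fun l _ => ?_
  exact ((Lp.memLp f).eval_piLp l).smul (hm k l)

/-- The bounded operator `f ↦ m f` on `L²_#(Q)`, for `m ∈ L^∞_#(Q)`. -/
def mulOp {𝕜 : Type*} [RCLike 𝕜] {d : ℕ} {ι : Type*} [Fintype ι]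
    (m : Space d → Matrix ι ι ℝ) (hm : IsLinfty m) : L2Q 𝕜 d ι →L[𝕜] L2Q 𝕜 d ι :=
  LinearMap.mkContinuousOfExistsBound
    { toFun := fun f => (hm.memLp_mulFun f).toLp _
      map_add' := by
        intro f g
        rw [← MemLp.toLp_add]
        refine MemLp.toLp_congr _ _ ?_
        filter_upwards [Lp.coeFn_add f g] with y hy
        ext k
        simp only [mulFun, hy, Pi.add_apply, PiLp.add_apply, smul_add, Finset.sum_add_distrib]
      map_smul' := by
        intro c f
        rw [RingHom.id_apply, ← MemLp.toLp_const_smul]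
        refine MemLp.toLp_congr _ _ ?_
        filter_upwards [Lp.coeFn_smul c f] with y hy
        ext k
        simp only [mulFun, hy, Pi.smul_apply, PiLp.smul_apply, Finset.smul_sum, smul_comm c] }
    (by
      obtain ⟨C, hC0, hC⟩ := hm.exists_bound
      refine ⟨Fintype.card ι * (Fintype.card ι * C), fun f => ?_⟩
      refine Lp.norm_le_mul_norm_of_ae_le_mul ?_
      filter_upwards [hC, (hm.memLp_mulFun f).coeFn_toLp] with y hy h
      change ‖((hm.memLp_mulFun f).toLp _ : L2Q 𝕜 d ι) y‖ ≤ _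
      rw [h]
      exact norm_mulFun_le hC0 hy f)

lemma mulOp_coeFn {𝕜 : Type*} [RCLike 𝕜] {d : ℕ} {ι : Type*} [Fintype ι]
    (m : Space d → Matrix ι ι ℝ) (hm : IsLinfty m) (f : L2Q 𝕜 d ι) :
    mulOp m hm f =ᵐ[cellMeasure d] mulFun m f :=
  (hm.memLp_mulFun f).coeFn_toLp

/-- The `j`-th column `(ψ_{ij})_i` of a tensor field `ψ`. -/
def colOp {𝕜 : Type*} [RCLike 𝕜] {d n : ℕ} (j : Fin d) :
    L2Q 𝕜 d (Fin n × Fin d) →L[𝕜] L2Q 𝕜 d (Fin n) :=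
  ContinuousLinearMap.compLpL 2 (cellMeasure d)
    (LinearMap.toContinuousLinearMap
      ({ toFun := fun ζ => WithLp.toLp 2 fun i => ζ (i, j)
         map_add' := fun _ _ => rfl
         map_smul' := fun _ _ => rfl } :
        EuclideanSpace 𝕜 (Fin n × Fin d) →ₗ[𝕜] EuclideanSpace 𝕜 (Fin n)))

/-! ### The square root of a non-negative tensor -/

/-- The square root `A^{1/2}` of a symmetric non-negative matrix, by functional calculus. -/
def tensorSqrt {ι : Type*} [Fintype ι] [DecidableEq ι] (A : Matrix ι ι ℝ) : Matrix ι ι ℝ :=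
  cfc Real.sqrt A

lemma tensorSqrt_mul_self {ι : Type*} [Fintype ι] [DecidableEq ι] {A : Matrix ι ι ℝ}
    (hA : A.PosSemidef) : tensorSqrt A * tensorSqrt A = A := by
  have hs : IsSelfAdjoint A := hA.1
  have h0 : ∀ x ∈ spectrum ℝ A, 0 ≤ x :=
    fun x hx => (Matrix.posSemidef_iff_isHermitian_and_spectrum_nonneg.1 hA).2 hx
  rw [tensorSqrt, ← cfc_mul Real.sqrt Real.sqrt A (Real.continuous_sqrt.continuousOn)
    (Real.continuous_sqrt.continuousOn)]
  exact (cfc_congr (g := id) (fun x hx => Real.mul_self_sqrt (h0 x hx))).trans (cfc_id ℝ A)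

lemma tensorSqrt_isSymm {ι : Type*} [Fintype ι] [DecidableEq ι] (A : Matrix ι ι ℝ) :
    (tensorSqrt A).IsSymm := by
  have h : IsSelfAdjoint (cfc Real.sqrt A) := cfc_predicate Real.sqrt A
  have h2 : (cfc Real.sqrt A).conjTranspose = cfc Real.sqrt A := h
  rwa [Matrix.conjTranspose_eq_transpose_of_trivial] at h2

lemma abs_tensorSqrt_le {ι : Type*} [Fintype ι] [DecidableEq ι] {A : Matrix ι ι ℝ}
    (hA : A.PosSemidef) (k l : ι) : |tensorSqrt A k l| ≤ 1 + |A k k| := by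
  have h1 : ∑ j, tensorSqrt A k j ^ 2 = A k k := by
    conv_rhs => rw [← tensorSqrt_mul_self hA]
    rw [Matrix.mul_apply]
    refine Finset.sum_congr rfl fun j _ => ?_
    rw [pow_two, (tensorSqrt_isSymm A).apply]
  have h2 : tensorSqrt A k l ^ 2 ≤ A k k := by
    rw [← h1]
    exact Finset.single_le_sum (f := fun j => tensorSqrt A k j ^ 2) (fun _ _ => sq_nonneg _)
      (Finset.mem_univ l)
  have h3 := le_abs_self (A k k)
  rw [abs_le]
  constructor <;> nlinarith [sq_nonneg (tensorSqrt A k l - 1), sq_nonneg (tensorSqrt A k l + 1)]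

/-- A sequence of polynomials converging pointwise to the square root on `[0, ∞)`. -/
lemma exists_polynomial_sqrt : ∃ P : ℕ → Polynomial ℝ,
    ∀ x : ℝ, 0 ≤ x → Tendsto (fun k => (P k).eval x) atTop (𝓝 (Real.sqrt x)) := by
  have h : ∀ k : ℕ, ∃ p : Polynomial ℝ, ∀ x ∈ Set.Icc (0 : ℝ) k,
      |p.eval x - Real.sqrt x| < 1 / ((k : ℝ) + 1) := fun k =>
    exists_polynomial_near_of_continuousOn 0 k Real.sqrt Real.continuous_sqrt.continuousOn _
      (by positivity)
  choose P hP using h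
  refine ⟨P, fun x hx => ?_⟩
  rw [tendsto_iff_dist_tendsto_zero]
  refine squeeze_zero' (Eventually.of_forall fun _ => dist_nonneg) ?_
    tendsto_one_div_add_atTop_nhds_zero_nat
  obtain ⟨N, hN⟩ := exists_nat_ge x
  filter_upwards [eventually_ge_atTop N] with k hk
  exact (hP k x ⟨hx, hN.trans (by exact_mod_cast hk)⟩).le

lemma tendsto_aeval_tensorSqrt {ι : Type*} [Fintype ι] [DecidableEq ι] {P : ℕ → Polynomial ℝ}
    (hP : ∀ x : ℝ, 0 ≤ x → Tendsto (fun k => (P k).eval x) atTop (𝓝 (Real.sqrt x)))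
    {A : Matrix ι ι ℝ} (hA : A.PosSemidef) :
    Tendsto (fun k => Polynomial.aeval A (P k)) atTop (𝓝 (tensorSqrt A)) := by
  have hs : IsSelfAdjoint A := hA.1
  have e : ∀ k, Polynomial.aeval A (P k) = hA.1.cfc (fun x => (P k).eval x) := fun k => by
    rw [← cfc_polynomial (P k) A hs, hA.1.cfc_eq]
  rw [tensorSqrt, hA.1.cfc_eq]
  simp_rw [e, Matrix.IsHermitian.cfc, Unitary.conjStarAlgAut_apply]
  refine Tendsto.mul (Tendsto.mul tendsto_const_nhds ?_) tendsto_const_nhds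
  refine ((continuous_id.matrix_diagonal).tendsto _).comp ?_
  refine tendsto_pi_nhds.2 fun i => ?_
  simpa using hP _ (hA.eigenvalues_nonneg i)

lemma IsLinfty.aestronglyMeasurable_aeval {d : ℕ} {ι : Type*} [Fintype ι] [DecidableEq ι]
    {m : Space d → Matrix ι ι ℝ} (hm : IsLinfty m) (p : Polynomial ℝ) (k l : ι) :
    AEStronglyMeasurable (fun y => Polynomial.aeval (m y) p k l) (cellMeasure d) := by
  have hpow : ∀ (N : ℕ) (k l : ι),
      AEStronglyMeasurable (fun y => (m y ^ N) k l) (cellMeasure d) := by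
    intro N
    induction N with
    | zero => intro k l; simpa using aestronglyMeasurable_const
    | succ N ih =>
      intro k l
      simp_rw [pow_succ, Matrix.mul_apply]
      exact Finset.aestronglyMeasurable_fun_sum _ fun j _ => (ih k j).mul (hm j l).1
  simp_rw [Polynomial.aeval_eq_sum_range, Matrix.sum_apply, Matrix.smul_apply]
  exact Finset.aestronglyMeasurable_fun_sum _ fun j _ => (hpow j k l).const_smul (p.coeff j)

lemma IsLinfty.tensorSqrt {d : ℕ} {ι : Type*} [Fintype ι] [DecidableEq ι]
    {m : Space d → Matrix ι ι ℝ} (hm : IsLinfty m)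
    (hpos : ∀ᵐ y ∂(cellMeasure d), (m y).PosSemidef) :
    IsLinfty (fun y => TwoScale.tensorSqrt (m y)) := by
  intro k l
  obtain ⟨P, hP⟩ := exists_polynomial_sqrt
  obtain ⟨C, -, hC⟩ := hm.exists_bound
  refine memLp_top_of_bound (aestronglyMeasurable_of_tendsto_ae atTop
    (fun N => hm.aestronglyMeasurable_aeval (P N) k l) ?_) (1 + C) ?_
  · filter_upwards [hpos] with y hy
    exact tendsto_pi_nhds.1 (tendsto_pi_nhds.1 (tendsto_aeval_tensorSqrt hP hy) k) l
  · filter_upwards [hpos, hC] with y hy hb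
    exact (abs_tensorSqrt_le hy k l).trans (by linarith [hb k k])

/-! ### The coefficients, and the spaces `V` and `W` -/

/-- The coefficients of the degenerating system: the tensors `a^{(1)}` and `a^{(0)}`, with
`a_{ijpq}` stored as the matrix entry `((i,j),(p,q))`, and the density `ρ`. -/
structure Coefficients (d n : ℕ) where
  a1 : Space d → Matrix (Fin n × Fin d) (Fin n × Fin d) ℝ
  a0 : Space d → Matrix (Fin n × Fin d) (Fin n × Fin d) ℝ
  ρ : Space d → ℝ
  ν : ℝ
  A0 : Matrix (Fin n × Fin d) (Fin n × Fin d) ℝ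
  a1_linfty : IsLinfty a1
  a0_linfty : IsLinfty a0
  ρ_linfty : MemLp ρ ∞ (cellMeasure d)
  ν_pos : 0 < ν
  ρ_lower : ∀ᵐ y ∂(cellMeasure d), ν ≤ ρ y
  a1_symm : ∀ᵐ y ∂(cellMeasure d), (a1 y).IsSymm
  a0_symm : ∀ᵐ y ∂(cellMeasure d), (a0 y).IsSymm
  a1_nonneg : ∀ᵐ y ∂(cellMeasure d), ∀ ζ : Fin n × Fin d → ℝ, 0 ≤ ζ ⬝ᵥ a1 y *ᵥ ζ
  sum_elliptic : ∀ᵐ y ∂(cellMeasure d), ∀ ζ : Fin n × Fin d → ℝ,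
    ζ ⬝ᵥ A0 *ᵥ ζ ≤ ζ ⬝ᵥ (a0 y + a1 y) *ᵥ ζ
  A0_elliptic : ∀ (ξ : Fin n → ℝ) (η : Fin d → ℝ),
    ν * (∑ i, ξ i ^ 2) * (∑ j, η j ^ 2) ≤
      ∑ i, ∑ j, ∑ p, ∑ q, A0 (i, j) (p, q) * ξ i * η j * ξ p * η q

namespace Coefficients

variable {d n : ℕ} (c : Coefficients d n)

lemma a1_posSemidef : ∀ᵐ y ∂(cellMeasure d), (c.a1 y).PosSemidef := by
  filter_upwards [c.a1_symm, c.a1_nonneg] with y h1 h2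
  refine Matrix.PosSemidef.of_dotProduct_mulVec_nonneg ?_ fun ζ => by simpa using h2 ζ
  rwa [Matrix.IsHermitian, Matrix.conjTranspose_eq_transpose_of_trivial]

lemma sqrt_linfty : IsLinfty (fun y => tensorSqrt (c.a1 y)) :=
  c.a1_linfty.tensorSqrt c.a1_posSemidef

lemma density_linfty : IsLinfty (fun y => c.ρ y • (1 : Matrix (Fin n) (Fin n) ℝ)) := by
  intro k l
  simpa [mul_comm] using c.ρ_linfty.const_mul ((1 : Matrix (Fin n) (Fin n) ℝ) k l)

variable (𝕜 : Type*) [RCLike 𝕜]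

/-- Multiplication by `a^{(1)}(y)`. -/
def mulA1 : L2Q 𝕜 d (Fin n × Fin d) →L[𝕜] L2Q 𝕜 d (Fin n × Fin d) :=
  mulOp c.a1 c.a1_linfty

/-- Multiplication by `a^{(0)}(y)`. -/
def mulA0 : L2Q 𝕜 d (Fin n × Fin d) →L[𝕜] L2Q 𝕜 d (Fin n × Fin d) :=
  mulOp c.a0 c.a0_linfty

/-- Multiplication by `(a^{(1)}(y))^{1/2}`. -/
def mulSqrtA1 : L2Q 𝕜 d (Fin n × Fin d) →L[𝕜] L2Q 𝕜 d (Fin n × Fin d) :=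
  mulOp (fun y => tensorSqrt (c.a1 y)) c.sqrt_linfty

/-- Multiplication by `ρ(y)`. -/
def mulρ : L2Q 𝕜 d (Fin n) →L[𝕜] L2Q 𝕜 d (Fin n) :=
  mulOp (fun y => c.ρ y • (1 : Matrix (Fin n) (Fin n) ℝ)) c.density_linfty

/-- `V = {v ∈ (H¹_#(Q))^n : a^{(1)} ∇_y v = 0}`, with the `H¹` norm; an element is stored
together with its gradient. -/
def submoduleV : Submodule 𝕜 (PairL2 𝕜 d n) where
  carrier := {p | p ∈ H1per 𝕜 d n ∧ c.mulA1 𝕜 p.snd = 0}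
  zero_mem' := ⟨zero_mem _, by simp⟩
  add_mem' := fun {p q} hp hq => ⟨add_mem hp.1 hq.1, by simp [hp.2, hq.2]⟩
  smul_mem' := fun r p hp => ⟨Submodule.smul_mem _ r hp.1, by simp [hp.2]⟩

/-- `W = {ψ ∈ (L²_#(Q))^{n×d} : div_y((a^{(1)})^{1/2} ψ) = 0 in (H^{-1}_#(Q))^n}`, the divergence
acting on `v ∈ (H¹_#(Q))^n` as minus the pairing with `∇_y v`. -/
def submoduleW : Submodule 𝕜 (L2Q 𝕜 d (Fin n × Fin d)) where
  carrier := {ψ | ∀ v ∈ H1per 𝕜 d n, inner 𝕜 v.snd (c.mulSqrtA1 𝕜 ψ) = 0}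
  zero_mem' := fun v _ => by simp
  add_mem' := fun {ψ χ} hψ hχ v hv => by simp [inner_add_right, hψ v hv, hχ v hv]
  smul_mem' := fun r ψ hψ v hv => by simp [inner_smul_right, hψ v hv]

/-- The Hilbert space `V`. -/
def V : Type _ := c.submoduleV 𝕜

instance : NormedAddCommGroup (c.V 𝕜) := inferInstanceAs (NormedAddCommGroup (c.submoduleV 𝕜))
instance : InnerProductSpace 𝕜 (c.V 𝕜) :=
  inferInstanceAs (InnerProductSpace 𝕜 (c.submoduleV 𝕜))
instance : NormedSpace ℝ (c.V 𝕜) := inferInstanceAs (NormedSpace ℝ (c.submoduleV 𝕜))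
instance : IsScalarTower ℝ 𝕜 (c.V 𝕜) := inferInstanceAs (IsScalarTower ℝ 𝕜 (c.submoduleV 𝕜))

/-- The Hilbert space `W`. -/
def W : Type _ := c.submoduleW 𝕜

instance : NormedAddCommGroup (c.W 𝕜) := inferInstanceAs (NormedAddCommGroup (c.submoduleW 𝕜))
instance : InnerProductSpace 𝕜 (c.W 𝕜) :=
  inferInstanceAs (InnerProductSpace 𝕜 (c.submoduleW 𝕜))
instance : NormedSpace ℝ (c.W 𝕜) := inferInstanceAs (NormedSpace ℝ (c.submoduleW 𝕜))
instance : IsScalarTower ℝ 𝕜 (c.W 𝕜) := inferInstanceAs (IsScalarTower ℝ 𝕜 (c.submoduleW 𝕜))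

/-- The inclusion of `V` into the space of pairs. -/
def inclV : c.V 𝕜 →L[𝕜] PairL2 𝕜 d n := (c.submoduleV 𝕜).subtypeL

/-- The inclusion of `W` into `(L²_#(Q))^{n×d}`. -/
def inclW : c.W 𝕜 →L[𝕜] L2Q 𝕜 d (Fin n × Fin d) := (c.submoduleW 𝕜).subtypeL

/-- The field `v` of an element of `V`. -/
def val : c.V 𝕜 →L[𝕜] L2Q 𝕜 d (Fin n) :=
  (WithLp.fstL 2 𝕜 (L2Q 𝕜 d (Fin n)) (L2Q 𝕜 d (Fin n × Fin d))).comp (c.inclV 𝕜)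

/-- The gradient `∇_y v` of an element of `V`. -/
def grad : c.V 𝕜 →L[𝕜] L2Q 𝕜 d (Fin n × Fin d) :=
  (WithLp.sndL 2 𝕜 (L2Q 𝕜 d (Fin n)) (L2Q 𝕜 d (Fin n × Fin d))).comp (c.inclV 𝕜)

/-- The `j`-th column of `(a^{(1)})^{1/2} ψ`, for `ψ ∈ W`. -/
def sqrtCol (j : Fin d) : c.W 𝕜 →L[𝕜] L2Q 𝕜 d (Fin n) :=
  (colOp j).comp ((c.mulSqrtA1 𝕜).comp (c.inclW 𝕜))

/-! ### The space `U`, the operator `T` and the norm of `U` -/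

variable {𝕜}

/-- `div_x((a^{(1)}(y))^{1/2} Ψ(x,y))`, as a function of `x` with values in `(L²_#(Q))^n`. -/
def divx (Ψ : Space d → c.W 𝕜) (x : Space d) : L2Q 𝕜 d (Fin n) :=
  ∑ j : Fin d, fderiv ℝ (fun x' => c.sqrtCol 𝕜 j (Ψ x')) x (EuclideanSpace.single j 1)

variable (𝕜)

/-- `L²(Ω; V)`. -/
abbrev L2V (Ω : Set (Space d)) := Lp (c.V 𝕜) 2 (volume.restrict Ω)

/-- `L²(Ω; W)`. -/
abbrev L2W (Ω : Set (Space d)) := Lp (c.W 𝕜) 2 (volume.restrict Ω)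

variable {𝕜}

/-- The identity that links `u ∈ L²(Ω; V)` and `ξ ∈ L²(Ω; W)`. The test functions are the
restrictions to `Ω` of smooth compactly supported `Ψ : ℝ^d → W`; they need not vanish on the
boundary of `Ω`. -/
def IsFlux (Ω : Set (Space d)) (u : c.L2V 𝕜 Ω) (ξ : c.L2W 𝕜 Ω) : Prop :=
  ∀ Ψ : Space d → c.W 𝕜, ContDiff ℝ ∞ Ψ → HasCompactSupport Ψ →
    ∫ x in Ω, inner 𝕜 (Ψ x) (ξ x) = - ∫ x in Ω, inner 𝕜 (c.divx Ψ x) (c.val 𝕜 (u x))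

lemma isClosed_W : IsClosed (c.submoduleW 𝕜 : Set (L2Q 𝕜 d (Fin n × Fin d))) := by
  have e : (c.submoduleW 𝕜 : Set (L2Q 𝕜 d (Fin n × Fin d))) =
      ⋂ v ∈ H1per 𝕜 d n, {ψ | inner 𝕜 v.snd (c.mulSqrtA1 𝕜 ψ) = 0} := by
    ext ψ
    simp only [Set.mem_iInter]
    rfl
  rw [e]
  exact isClosed_biInter fun v _ => isClosed_eq
    (continuous_const.inner (c.mulSqrtA1 𝕜).continuous) continuous_const

instance : CompleteSpace (c.submoduleW 𝕜) := c.isClosed_W.completeSpace_coe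

instance : CompleteSpace (c.W 𝕜) :=
  inferInstanceAs (@CompleteSpace (c.submoduleW 𝕜) _)

lemma continuous_divx {Ψ : Space d → c.W 𝕜} (h : ContDiff ℝ ∞ Ψ) : Continuous (c.divx Ψ) := by
  refine continuous_finsetSum _ fun j _ => ?_
  have h1 : ContDiff ℝ ∞ (fun x' => c.sqrtCol 𝕜 j (Ψ x')) :=
    ((c.sqrtCol 𝕜 j).restrictScalars ℝ).contDiff.comp h
  exact (h1.continuous_fderiv (by simp)).clm_apply continuous_const

lemma hasCompactSupport_divx {Ψ : Space d → c.W 𝕜}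
    (hc : HasCompactSupport Ψ) : HasCompactSupport (c.divx Ψ) := by
  refine HasCompactSupport.intro hc.isCompact fun x hx => ?_
  refine Finset.sum_eq_zero fun j _ => ?_
  have hx' : x ∉ tsupport (fun x' => c.sqrtCol 𝕜 j (Ψ x')) := fun hmem =>
    hx (closure_mono (Function.support_subset_iff'.2 fun z hz => by
      rw [Function.notMem_support.1 hz, map_zero]) hmem)
  rw [fderiv_of_notMem_tsupport (𝕜 := ℝ) hx']
  rfl

end Coefficients

lemma integrable_inner_of_memLp {𝕜 E X : Type*} [RCLike 𝕜] [NormedAddCommGroup E]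
    [InnerProductSpace 𝕜 E] [MeasurableSpace X] {μ : Measure X} {f g : X → E}
    (hf : MemLp f 2 μ) (hg : MemLp g 2 μ) : Integrable (fun x => inner 𝕜 (f x) (g x)) μ := by
  refine (L2.integrable_inner (𝕜 := 𝕜) (hf.toLp f) (hg.toLp g)).congr ?_
  filter_upwards [hf.coeFn_toLp, hg.coeFn_toLp] with x h1 h2
  rw [h1, h2]

namespace Coefficients

variable {d n : ℕ} (c : Coefficients d n) {𝕜 : Type*} [RCLike 𝕜]

lemma integrable_divx_inner {Ω : Set (Space d)} {Ψ : Space d → c.W 𝕜} (h : ContDiff ℝ ∞ Ψ)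
    (hc : HasCompactSupport Ψ) (u : c.L2V 𝕜 Ω) :
    Integrable (fun x => inner 𝕜 (c.divx Ψ x) (c.val 𝕜 (u x))) (volume.restrict Ω) :=
  integrable_inner_of_memLp
    ((c.continuous_divx h).memLp_of_hasCompactSupport (c.hasCompactSupport_divx hc))
    ((c.val 𝕜).comp_memLp' (Lp.memLp u))

lemma integrable_test_inner {Ω : Set (Space d)} {Ψ : Space d → c.W 𝕜} (h : ContDiff ℝ ∞ Ψ)
    (hc : HasCompactSupport Ψ) (ξ : c.L2W 𝕜 Ω) :
    Integrable (fun x => inner 𝕜 (Ψ x) (ξ x)) (volume.restrict Ω) :=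
  integrable_inner_of_memLp (h.continuous.memLp_of_hasCompactSupport hc) (Lp.memLp ξ)

variable {c}

lemma IsFlux.zero (Ω : Set (Space d)) : c.IsFlux Ω (0 : c.L2V 𝕜 Ω) 0 := by
  intro Ψ _ _
  rw [integral_eq_zero_of_ae, integral_eq_zero_of_ae, neg_zero]
  · filter_upwards [Lp.coeFn_zero (c.V 𝕜) 2 (volume.restrict Ω)] with x hx
    rw [hx, Pi.zero_apply, map_zero, inner_zero_right, Pi.zero_apply]
  · filter_upwards [Lp.coeFn_zero (c.W 𝕜) 2 (volume.restrict Ω)] with x hx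
    rw [hx, Pi.zero_apply, inner_zero_right, Pi.zero_apply]

lemma IsFlux.add {Ω : Set (Space d)} {u v : c.L2V 𝕜 Ω} {ξ η : c.L2W 𝕜 Ω}
    (hu : c.IsFlux Ω u ξ) (hv : c.IsFlux Ω v η) : c.IsFlux Ω (u + v) (ξ + η) := by
  intro Ψ h hc
  have e1 := integral_add (c.integrable_test_inner h hc ξ) (c.integrable_test_inner h hc η)
  have e2 := integral_add (c.integrable_divx_inner h hc u) (c.integrable_divx_inner h hc v)
  have h1 : ∀ᵐ x ∂(volume.restrict Ω), inner 𝕜 (Ψ x) ((ξ + η : c.L2W 𝕜 Ω) x) =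
      inner 𝕜 (Ψ x) (ξ x) + inner 𝕜 (Ψ x) (η x) := by
    filter_upwards [Lp.coeFn_add ξ η] with x hx
    rw [hx, Pi.add_apply, inner_add_right]
  have h2 : ∀ᵐ x ∂(volume.restrict Ω), inner 𝕜 (c.divx Ψ x) (c.val 𝕜 ((u + v : c.L2V 𝕜 Ω) x)) =
      inner 𝕜 (c.divx Ψ x) (c.val 𝕜 (u x)) + inner 𝕜 (c.divx Ψ x) (c.val 𝕜 (v x)) := by
    filter_upwards [Lp.coeFn_add u v] with x hx
    rw [hx, Pi.add_apply, (c.val 𝕜).map_add, inner_add_right]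
  rw [integral_congr_ae h1, integral_congr_ae h2, e1, e2, hu Ψ h hc, hv Ψ h hc, neg_add]

lemma IsFlux.smul {Ω : Set (Space d)} {u : c.L2V 𝕜 Ω} {ξ : c.L2W 𝕜 Ω}
    (r : 𝕜) (hu : c.IsFlux Ω u ξ) : c.IsFlux Ω (r • u) (r • ξ) := by
  intro Ψ h hc
  have e := congrArg (fun z : 𝕜 => r * z) (hu Ψ h hc)
  simp only [mul_neg, ← integral_const_mul] at e
  refine (integral_congr_ae ?_).trans (e.trans (congrArg _ (integral_congr_ae ?_)))
  · filter_upwards [Lp.coeFn_smul r ξ] with x hx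
    rw [hx, Pi.smul_apply, inner_smul_right]
  · filter_upwards [Lp.coeFn_smul r u] with x hx
    rw [hx, Pi.smul_apply, (c.val 𝕜).map_smul, inner_smul_right]

/-- The flux `ξ` is determined by `u`. -/
lemma IsFlux.unique {Ω : Set (Space d)} {u : c.L2V 𝕜 Ω} {ξ η : c.L2W 𝕜 Ω}
    (hξ : c.IsFlux Ω u ξ) (hη : c.IsFlux Ω u η) : ξ = η := by
  have hint : ∀ ζ : c.L2W 𝕜 Ω, LocallyIntegrable ζ (volume.restrict Ω) := fun ζ =>
    (Lp.memLp ζ).locallyIntegrable (by norm_num)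
  refine Lp.ext (ae_eq_of_integral_contDiff_smul_eq (hint ξ) (hint η) fun g hg hgc => ?_)
  refine ext_inner_left 𝕜 fun w => ?_
  have hi : ∀ ζ : c.L2W 𝕜 Ω, Integrable (fun x => g x • ζ x) (volume.restrict Ω) := fun ζ =>
    (hint ζ).integrable_smul_left_of_hasCompactSupport hg.continuous hgc
  rw [← integral_inner (hi ξ), ← integral_inner (hi η)]
  have hΨ : ContDiff ℝ ∞ (fun x => g x • w) := hg.smul contDiff_const
  have hΨc : HasCompactSupport (fun x => g x • w) := hgc.smul_right
  have e := (hξ _ hΨ hΨc).trans (hη _ hΨ hΨc).symm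
  have hs : ∀ (r : ℝ) (z : c.W 𝕜), inner 𝕜 (r • w) z = inner 𝕜 w (r • z) := fun r z => by
    rw [RCLike.real_smul_eq_coe_smul (K := 𝕜), RCLike.real_smul_eq_coe_smul (K := 𝕜),
      inner_smul_left, inner_smul_right, RCLike.conj_ofReal]
  simpa only [hs] using e

variable (c) (𝕜)

/-- The space `U` of those `u ∈ L²(Ω; V)` that possess a flux `ξ ∈ L²(Ω; W)`. -/
def U (Ω : Set (Space d)) : Submodule 𝕜 (c.L2V 𝕜 Ω) where
  carrier := {u | ∃ ξ : c.L2W 𝕜 Ω, c.IsFlux Ω u ξ}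
  zero_mem' := ⟨0, IsFlux.zero Ω⟩
  add_mem' := fun ⟨ξ, hξ⟩ ⟨η, hη⟩ => ⟨ξ + η, hξ.add hη⟩
  smul_mem' := fun r _ ⟨ξ, hξ⟩ => ⟨r • ξ, hξ.smul r⟩

/-- The linear operator `T : U → L²(Ω; W)`, `T u = ξ`. -/
def T (Ω : Set (Space d)) : c.U 𝕜 Ω →ₗ[𝕜] c.L2W 𝕜 Ω where
  toFun u := u.2.choose
  map_add' u v := ((u + v).2.choose_spec).unique (u.2.choose_spec.add v.2.choose_spec)
  map_smul' r u := ((r • u).2.choose_spec).unique (u.2.choose_spec.smul r)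

lemma isFlux_T {Ω : Set (Space d)} (u : c.U 𝕜 Ω) : c.IsFlux Ω u.1 (c.T 𝕜 Ω u) :=
  u.2.choose_spec

variable {𝕜}

/-- The sesquilinear form `Q(u, w)` on `U` (linear in `u`; Mathlib's inner product is
conjugate-linear in its first argument). -/
def form {Ω : Set (Space d)} (u w : c.U 𝕜 Ω) : 𝕜 :=
  (∫ x in Ω, inner 𝕜 (c.T 𝕜 Ω w x) (c.T 𝕜 Ω u x)) +
  (∫ x in Ω, inner 𝕜 (c.grad 𝕜 (w.1 x)) (c.mulA0 𝕜 (c.grad 𝕜 (u.1 x)))) +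
  ∫ x in Ω, inner 𝕜 (c.val 𝕜 (w.1 x)) (c.mulρ 𝕜 (c.val 𝕜 (u.1 x)))

/-- The norm `‖u‖_U = Q(u, u)^{1/2}`. -/
def normU {Ω : Set (Space d)} (u : c.U 𝕜 Ω) : ℝ := Real.sqrt (RCLike.re (c.form u u))

variable (𝕜)

/-- `C_0^∞(Ω; V)`, as a set of classes in `L²(Ω; V)`. -/
def testFunctions (Ω : Set (Space d)) : Set (c.L2V 𝕜 Ω) :=
  {f | ∃ φ : Space d → c.V 𝕜, ContDiff ℝ ∞ φ ∧ HasCompactSupport φ ∧ tsupport φ ⊆ Ω ∧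
    f =ᵐ[volume.restrict Ω] φ}

end Coefficients

/-- A domain `Ω` is strictly star-shaped if, for some `x₀ ∈ Ω`, contractions towards `x₀` map
the closure of `Ω` into `Ω`. -/
def IsStrictlyStarShaped {d : ℕ} (Ω : Set (Space d)) : Prop :=
  IsOpen Ω ∧ ∃ x₀ ∈ Ω, ∀ x ∈ closure Ω, ∀ t ∈ Set.Ico (0 : ℝ) 1, x₀ + t • (x - x₀) ∈ Ω

end

end TwoScale

/-! Let `B_j : V → W` be the adjoint of `ψ ↦ j`-th column of `(a^{(1)})^{1/2} ψ`, composed with `v ↦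
v`. Then `T u = ∑ j, ∂_{x_j} (B_j u)` in the weak sense: `T` is a first-order differential operator
in `x` whose coefficients are bounded operators independent of `x`. The statement is therefore a
density theorem of Friedrichs type for functions with values in Hilbert spaces.

The test functions in the definition of `U` need not vanish on `∂Ω`. Hence the extensions by zero of
`u` and `ξ = T u` still satisfy the flux identity, now on all of `ℝ^d`
(`IsFlux.isGlobalFlux_indicator`), and everything else happens on `ℝ^d`. Three operations respect
that identity: multiplication by a cut-off, up to a bounded commutator (`IsGlobalFlux.smul_cutoff`);
dilation, up to a factor `s` (`IsGlobalFlux.dilation`); and convolution, exactly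
(`IsGlobalFlux.smoothFlux_convolution`).

A wide cut-off makes the support bounded. A dilation with `s > 1` contracts it towards `x₀`, and
strict star-shapedness places it in a compact subset of `Ω`. A fine mollification then gives a test
function. Each operation changes `u` and `ξ` little in `L²`, and `‖·‖_U` is bounded by the graph
norm `‖u‖ + ‖T u‖` (`exists_normU_le`), so no lower bound on the form is needed. -/

open scoped Convolution

namespace MeasureTheory

/-! ### Translations and mollification in `L²` -/

section Translation

variable {E F : Type*} [NormedAddCommGroup E] [NormedSpace ℝ E] [FiniteDimensional ℝ E]
  [MeasurableSpace E] [BorelSpace E] {μ : Measure E} [μ.IsAddHaarMeasure]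
  [NormedAddCommGroup F]

/-- Translations are strongly continuous on `L²`. -/
lemma MemLp.tendsto_eLpNorm_translate_sub {u : E → F} (hu : MemLp u 2 μ) :
    Tendsto (fun h : E => eLpNorm (fun x => u (x - h) - u x) 2 μ) (𝓝 0) (𝓝 0) := by
  have : Fact ((2 : ℝ≥0∞) ≠ ⊤) := ⟨by norm_num⟩
  set f : Lp F 2 μ := hu.toLp u
  -- The translation action on `Lp` is continuous for finite exponents. The element `mk (-h)` acts
  -- as `x ↦ f (-h + x)`, whence the sign.
  have hc : Continuous fun h : E => DomAddAct.mk (-h) +ᵥ f :=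
    (DomAddAct.continuous_mk.comp continuous_neg).vadd continuous_const
  have h0 := (hc.edist continuous_const).tendsto (0 : E) (f := fun h => edist _ f)
  simp only [neg_zero, DomAddAct.mk_zero, zero_vadd, edist_self] at h0
  refine h0.congr fun h => ?_
  rw [DomAddAct.mk_vadd_toLp, Lp.edist_toLp_toLp]
  refine eLpNorm_congr_ae (Eventually.of_forall fun x => ?_)
  simp [neg_add_eq_sub]

variable [NormedSpace ℝ F] [CompleteSpace F]

/-- Jensen's inequality: the normalised bump is a probability density, so the left side is the
squared norm of a mean of `u (x - h) - u x`, at most the mean of the squared norms. -/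
lemma enorm_convolution_sub_sq_le (φ : ContDiffBump (0 : E)) {u : E → F}
    (hu : MemLp u 2 μ) (x : E) :
    ‖(φ.normed μ ⋆[ContinuousLinearMap.lsmul ℝ ℝ, μ] u) x - u x‖ₑ ^ 2 ≤
      ∫⁻ h, ENNReal.ofReal (φ.normed μ h) * ‖u (x - h) - u x‖ₑ ^ 2 ∂μ := by
  set η := φ.normed μ with hη
  have hηm : Measurable fun h => ENNReal.ofReal (η h) :=
    φ.continuous_normed.measurable.ennreal_ofReal
  set P : Measure E := μ.withDensity fun h => ENNReal.ofReal (η h) with hP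
  have hP1 : IsProbabilityMeasure P := ⟨by
    rw [hP, withDensity_apply _ MeasurableSet.univ, setLIntegral_univ,
      ← ofReal_integral_eq_lintegral_ofReal φ.integrable_normed
        (Eventually.of_forall φ.nonneg_normed), φ.integral_normed, ENNReal.ofReal_one]⟩
  have hum : AEStronglyMeasurable (fun h => u (x - h) - u x) μ :=
    (hu.1.comp_quasiMeasurePreserving
      (quasiMeasurePreserving_sub_left μ x)).sub aestronglyMeasurable_const
  have hex : Integrable (fun h => η h • u (x - h)) μ :=
    (φ.hasCompactSupport_normed.convolutionExists_left (ContinuousLinearMap.lsmul ℝ ℝ)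
      φ.continuous_normed (hu.locallyIntegrable (by norm_num)) x)
  have e1 : (η ⋆[ContinuousLinearMap.lsmul ℝ ℝ, μ] u) x - u x = ∫ h, (u (x - h) - u x) ∂P := by
    rw [hP, integral_withDensity_eq_integral_toReal_smul hηm
      (Eventually.of_forall fun _ => ENNReal.ofReal_lt_top)]
    have hη0 : ∀ h, (ENNReal.ofReal (η h)).toReal = η h :=
      fun h => ENNReal.toReal_ofReal (φ.nonneg_normed h)
    simp only [hη0, smul_sub]
    rw [integral_sub hex (φ.integrable_normed.smul_const _), φ.integral_normed_smul μ]
    rfl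
  have e2 : eLpNorm (fun h => u (x - h) - u x) 1 P ≤ eLpNorm (fun h => u (x - h) - u x) 2 P :=
    eLpNorm_le_eLpNorm_of_exponent_le (by norm_num)
      (hum.mono_ac (withDensity_absolutelyContinuous _ _))
  have e3 : eLpNorm (fun h => u (x - h) - u x) 2 P ^ 2 =
      ∫⁻ h, ENNReal.ofReal (η h) * ‖u (x - h) - u x‖ₑ ^ 2 ∂μ := by
    have := eLpNorm_nnreal_pow_eq_lintegral (f := fun h => u (x - h) - u x) (μ := P) (p := 2)
      (by norm_num)
    simp only [NNReal.coe_ofNat, ENNReal.coe_ofNat, ENNReal.rpow_ofNat] at this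
    rw [this, hP, lintegral_withDensity_eq_lintegral_mul₀ hηm.aemeasurable
      (hum.enorm.pow_const 2)]
    rfl
  rw [e1, ← e3]
  gcongr
  refine (enorm_integral_le_lintegral_enorm _).trans ?_
  rw [← eLpNorm_one_eq_lintegral_enorm]
  exact e2

/-- Mollification converges in `L²`. -/
lemma MemLp.exists_eLpNorm_convolution_sub_le {u : E → F} (hu : MemLp u 2 μ) {ε : ℝ≥0∞}
    (hε : 0 < ε) : ∃ δ > 0, ∀ φ : ContDiffBump (0 : E), φ.rOut < δ →
      eLpNorm (φ.normed μ ⋆[ContinuousLinearMap.lsmul ℝ ℝ, μ] u - u) 2 μ ≤ ε := by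
  obtain ⟨δ, hδ, H⟩ := Metric.eventually_nhds_iff.1
    ((ENNReal.tendsto_nhds_zero.1 hu.tendsto_eLpNorm_translate_sub) ε hε)
  refine ⟨δ, hδ, fun φ hφ => ?_⟩
  set η := φ.normed μ with hη
  have sq (g : E → F) : eLpNorm g 2 μ ^ 2 = ∫⁻ x, ‖g x‖ₑ ^ 2 ∂μ := by
    have := eLpNorm_nnreal_pow_eq_lintegral (f := g) (μ := μ) (p := 2) (by norm_num)
    simpa only [NNReal.coe_ofNat, ENNReal.coe_ofNat, ENNReal.rpow_ofNat] using this
  rw [← ENNReal.pow_le_pow_left_iff two_ne_zero, sq]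
  have hm : AEMeasurable (Function.uncurry fun (x h : E) =>
      ENNReal.ofReal (η h) * ‖u (x - h) - u x‖ₑ ^ 2) (μ.prod μ) := by
    refine AEMeasurable.mul (φ.continuous_normed.measurable.ennreal_ofReal.comp
      measurable_snd).aemeasurable ?_
    refine AEMeasurable.pow_const (AEStronglyMeasurable.enorm ?_) 2
    exact (hu.1.comp_quasiMeasurePreserving (quasiMeasurePreserving_sub μ μ)).sub hu.1.comp_fst
  calc ∫⁻ x, ‖(η ⋆[ContinuousLinearMap.lsmul ℝ ℝ, μ] u - u) x‖ₑ ^ 2 ∂μ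
      -- After Tonelli the inner integral is the squared `L²` distance of `u` to its translate by
      -- `h`; it is at most `ε ^ 2` when `‖h‖ < δ`, and all other `h` lie off the support of `η`.
      ≤ ∫⁻ x, ∫⁻ h, ENNReal.ofReal (η h) * ‖u (x - h) - u x‖ₑ ^ 2 ∂μ ∂μ :=
        lintegral_mono fun x => enorm_convolution_sub_sq_le φ hu x
    _ = ∫⁻ h, ∫⁻ x, ENNReal.ofReal (η h) * ‖u (x - h) - u x‖ₑ ^ 2 ∂μ ∂μ :=
        lintegral_lintegral_swap hm
    _ ≤ ∫⁻ h, ENNReal.ofReal (η h) * ε ^ 2 ∂μ := by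
        refine lintegral_mono fun h => ?_
        dsimp only
        rw [lintegral_const_mul' _ _ ENNReal.ofReal_ne_top, ← sq]
        by_cases hh : dist h 0 < δ
        · gcongr
          exact H hh
        · have : η h = 0 := by
            rw [← Function.notMem_support, φ.support_normed_eq, Metric.mem_ball]
            intro h'; exact hh (h'.trans hφ)
          simp [this]
    _ = ε ^ 2 := by
        rw [lintegral_mul_const _ φ.continuous_normed.measurable.ennreal_ofReal,
          ← ofReal_integral_eq_lintegral_ofReal φ.integrable_normed
            (Eventually.of_forall φ.nonneg_normed), φ.integral_normed, ENNReal.ofReal_one, one_mul]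

end Translation

/-! ### Dilations and cut-offs in `L²` -/

section Dilation

variable {E F : Type*} [NormedAddCommGroup E] [NormedSpace ℝ E] [FiniteDimensional ℝ E]
  [MeasurableSpace E] [BorelSpace E] {μ : Measure E} [μ.IsAddHaarMeasure]
  [NormedAddCommGroup F]

lemma map_add_smul_sub (x₀ : E) {s : ℝ} (hs : 0 < s) :
    μ.map (fun x => x₀ + s • (x - x₀)) =
      ENNReal.ofReal (s ^ Module.finrank ℝ E)⁻¹ • μ := by
  have h : (fun x => x₀ + s • (x - x₀)) = (fun x => x + (x₀ - s • x₀)) ∘ (s • ·) := by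
    ext x
    simp only [Function.comp, smul_sub]
    abel
  rw [h, ← Measure.map_map (measurable_add_const _) (measurable_const_smul s),
    Measure.map_addHaar_smul μ hs.ne', Measure.map_smul, (measurePreserving_add_right μ _).map_eq,
    abs_of_nonneg (by positivity)]

omit [FiniteDimensional ℝ E] in
lemma measurableEmbedding_add_smul_sub (x₀ : E) {s : ℝ} (hs : 0 < s) :
    MeasurableEmbedding (fun x => x₀ + s • (x - x₀)) := by
  have h : (fun x => x₀ + s • (x - x₀)) =
      (fun x => x₀ + x) ∘ (s • ·) ∘ (fun x => x - x₀) := rfl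
  rw [h]
  exact (measurableEmbedding_addLeft x₀).comp
    ((measurableEmbedding_const_smul₀ hs.ne').comp (measurableEmbedding_subRight x₀))

lemma integral_comp_add_smul_sub [NormedSpace ℝ F] (x₀ : E) {s : ℝ} (hs : 0 < s) (f : E → F) :
    ∫ x, f (x₀ + s • (x - x₀)) ∂μ = (s ^ Module.finrank ℝ E)⁻¹ • ∫ x, f x ∂μ := by
  rw [← (measurableEmbedding_add_smul_sub x₀ hs).integral_map, map_add_smul_sub x₀ hs,
    integral_smul_measure, ENNReal.toReal_ofReal (by positivity)]

/-- The Jacobian factor is `s⁻¹` to the power of the dimension, at most `1` for `s ≥ 1`. This bound,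
uniform in `s`, lets convergence pass from a dense class to all of `L²`. -/
lemma eLpNorm_comp_add_smul_sub_le (x₀ : E) {s : ℝ} (hs : 1 ≤ s) (f : E → F) :
    eLpNorm (fun x => f (x₀ + s • (x - x₀))) 2 μ ≤ eLpNorm f 2 μ := by
  have hs0 : 0 < s := by linarith
  have := (measurableEmbedding_add_smul_sub x₀ hs0).eLpNorm_map_measure (g := f) (p := 2) (μ := μ)
  rw [map_add_smul_sub x₀ hs0] at this
  change eLpNorm (f ∘ _) 2 μ ≤ _
  rw [← this]
  refine eLpNorm_mono_measure _ ?_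
  refine Measure.le_iff'.2 fun t => ?_
  rw [Measure.smul_apply, smul_eq_mul]
  refine mul_le_of_le_one_left' ?_
  rw [ENNReal.ofReal_le_one]
  exact inv_le_one_of_one_le₀ (one_le_pow₀ hs)

lemma MemLp.comp_add_smul_sub {f : E → F} (hf : MemLp f 2 μ) (x₀ : E) {s : ℝ} (hs : 0 < s) :
    MemLp (fun x => f (x₀ + s • (x - x₀))) 2 μ := by
  have := (measurableEmbedding_add_smul_sub x₀ hs).memLp_map_measure_iff (g := f) (p := 2) (μ := μ)
  refine this.1 ?_
  rw [map_add_smul_sub x₀ hs]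
  exact hf.smul_measure ENNReal.ofReal_ne_top

/-- Dilations converge strongly to the identity on `L²`. -/
lemma MemLp.eventually_eLpNorm_dilation_sub_le [NormedSpace ℝ F] {f : E → F} (hf : MemLp f 2 μ) (x₀ : E) {ε : ℝ≥0∞}
    (hε : 0 < ε) :
    ∀ᶠ s : ℝ in 𝓝[>] 1, eLpNorm (fun x => f (x₀ + s • (x - x₀)) - f x) 2 μ ≤ ε := by
  have hε3 : ε / 3 ≠ 0 := (ENNReal.div_pos hε.ne' (by norm_num)).ne'
  obtain ⟨g, hgc, hfg, hgcont, hgm⟩ := hf.exists_hasCompactSupport_eLpNorm_sub_le (by norm_num) hε3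
  obtain ⟨R, hR⟩ := hgc.isCompact.isBounded.subset_closedBall x₀
  have key : ∀ᶠ s : ℝ in 𝓝[>] 1,
      eLpNorm ((fun x => g (x₀ + s • (x - x₀))) - g) 2 μ ≤ ε / 3 := by
    -- A function bounded by `δ` and supported in the ball has `L²` norm at most `δ` times the
    -- square root of the measure of the ball.
    obtain ⟨δ, hδ, hδε⟩ : ∃ δ : ℝ, 0 < δ ∧
        ENNReal.ofReal δ * μ (Metric.closedBall x₀ R) ^ (1 / (2 : ℝ≥0∞).toReal) ≤ ε / 3 := by
      have hM : μ (Metric.closedBall x₀ R) ^ (1 / (2 : ℝ≥0∞).toReal) ≠ ⊤ :=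
        (ENNReal.rpow_lt_top_of_nonneg (by norm_num) measure_closedBall_lt_top.ne).ne
      have ht : Tendsto (fun δ : ℝ => ENNReal.ofReal δ *
          μ (Metric.closedBall x₀ R) ^ (1 / (2 : ℝ≥0∞).toReal)) (𝓝[>] 0) (𝓝 0) := by
        have := (ENNReal.tendsto_ofReal (tendsto_id (α := ℝ) (x := 𝓝 0)))
        have := ENNReal.Tendsto.mul_const this (Or.inr hM)
        simp only [id, ENNReal.ofReal_zero, zero_mul] at this
        exact this.mono_left nhdsWithin_le_nhds
      obtain ⟨δ, h1, h2⟩ := ((ENNReal.tendsto_nhds_zero.1 ht _ (pos_iff_ne_zero.2 hε3)).and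
        self_mem_nhdsWithin).exists
      exact ⟨δ, h2, h1⟩
    obtain ⟨r, hr, hgu⟩ := Metric.uniformContinuous_iff.1
      (hgc.uniformContinuous_of_continuous hgcont) δ hδ
    -- The dilation moves points of the ball by at most `(s - 1) * |R|`. The absolute value is there
    -- because nothing forces `R ≥ 0` when `g` vanishes.
    have hlim : ∀ᶠ s : ℝ in 𝓝[>] 1, (s - 1) * |R| < r := by
      have : Tendsto (fun s : ℝ => (s - 1) * |R|) (𝓝 1) (𝓝 ((1 - 1) * |R|)) :=
        (Continuous.tendsto (by fun_prop) 1)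
      rw [sub_self, zero_mul] at this
      exact (this.eventually_lt_const hr).filter_mono nhdsWithin_le_nhds
    filter_upwards [hlim, self_mem_nhdsWithin] with s hs hs1
    have hs1 : 1 < s := hs1
    -- Composition with an expansion contracts the support, so one ball serves all `s > 1`.
    have hsup : Function.support (fun x => g (x₀ + s • (x - x₀))) ⊆ Metric.closedBall x₀ R := by
      intro x hx
      have h1 := hR (subset_tsupport g hx)
      rw [mem_closedBall_iff_norm, add_sub_cancel_left, norm_smul, Real.norm_of_nonneg
        (by linarith)] at h1
      rw [mem_closedBall_iff_norm]
      nlinarith [norm_nonneg (x - x₀)]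
    have hsup' : Function.support g ⊆ Metric.closedBall x₀ R := (subset_tsupport g).trans hR
    refine (eLpNorm_sub_le_of_dist_bdd μ (by norm_num) measurableSet_closedBall hδ.le
      (fun x => ?_) hsup hsup').trans hδε
    by_cases hx : x ∈ Metric.closedBall x₀ R
    · refine (hgu ?_).le
      have e : x₀ + s • (x - x₀) - x = (s - 1) • (x - x₀) := by
        rw [sub_smul, one_smul]; abel
      rw [dist_eq_norm, e, norm_smul, Real.norm_of_nonneg (by linarith)]
      rw [mem_closedBall_iff_norm] at hx
      exact (mul_le_mul_of_nonneg_left (hx.trans (le_abs_self R)) (by linarith)).trans_lt hs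
    · have h1 : g x = 0 := Function.notMem_support.1 fun h => hx (hsup' h)
      have h2 : g (x₀ + s • (x - x₀)) = 0 := Function.notMem_support.1 fun h => hx (hsup h)
      rw [h1, h2, dist_self]; exact hδ.le
  filter_upwards [key, self_mem_nhdsWithin] with s hs hs1
  have hs1 : (1 : ℝ) < s := hs1
  have e : (fun x => f (x₀ + s • (x - x₀)) - f x) =
      ((fun x => (f - g) (x₀ + s • (x - x₀))) + ((fun x => g (x₀ + s • (x - x₀))) - g)) -
        (f - g) := by
    ext x
    simp only [Pi.sub_apply, Pi.add_apply]
    abel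
  have m1 := ((hf.sub hgm).comp_add_smul_sub x₀ (by linarith : 0 < s)).1
  have m2 := ((hgm.comp_add_smul_sub x₀ (by linarith : 0 < s)).sub hgm).1
  rw [e]
  calc _ ≤ ε / 3 + ε / 3 + ε / 3 := by
        refine (eLpNorm_sub_le (m1.add m2) (hf.sub hgm).1 (by norm_num)).trans (add_le_add
          ((eLpNorm_add_le m1 m2 (by norm_num)).trans (add_le_add ?_ hs)) hfg)
        exact (eLpNorm_comp_add_smul_sub_le x₀ hs1.le _).trans hfg
    _ = ε := ENNReal.add_thirds ε

/-- Multiplication by dilated cut-off functions converges strongly to the identity on `L²`. -/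
lemma MemLp.eventually_eLpNorm_cutoff_sub_le [NormedSpace ℝ F] {f : E → F} (hf : MemLp f 2 μ)
    {χ : E → ℝ} (hχ0 : ∀ x, χ x ∈ Set.Icc (0 : ℝ) 1)
    (hχ1 : ∀ x, ‖x‖ ≤ 1 → χ x = 1) {ε : ℝ≥0∞} (hε : 0 < ε) :
    ∀ᶠ R : ℝ in atTop, eLpNorm (fun x => χ (R⁻¹ • x) • f x - f x) 2 μ ≤ ε := by
  obtain ⟨g, hgc, hfg, hgcont, hgm⟩ :=
    hf.exists_hasCompactSupport_eLpNorm_sub_le (by norm_num) hε.ne'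
  obtain ⟨M, hM⟩ := hgc.isCompact.isBounded.subset_closedBall 0
  filter_upwards [eventually_ge_atTop M, eventually_gt_atTop 0] with R hR hR0
  -- Pointwise `‖χ f - f‖ ≤ ‖f - g‖`: where `g ≠ 0` the cut-off equals `1`, and where `g = 0` the
  -- factor `χ - 1` has modulus at most `1`.
  refine le_trans (eLpNorm_mono_ae (Eventually.of_forall fun x => ?_)) hfg
  have e : χ (R⁻¹ • x) • f x - f x = (χ (R⁻¹ • x) - 1) • f x := by rw [sub_smul, one_smul]
  rw [e, norm_smul]
  by_cases hx : g x = 0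
  · rw [Pi.sub_apply, hx, sub_zero]
    refine mul_le_of_le_one_left (norm_nonneg _) ?_
    rw [Real.norm_eq_abs, abs_le]
    constructor <;> linarith [(hχ0 (R⁻¹ • x)).1, (hχ0 (R⁻¹ • x)).2]
  · have h1 := hM (subset_tsupport g hx)
    rw [mem_closedBall_zero_iff] at h1
    have h2 : ‖R⁻¹ • x‖ ≤ 1 := by
      rw [norm_smul, Real.norm_of_nonneg (by positivity), inv_mul_le_one₀ hR0]
      exact h1.trans hR
    rw [hχ1 _ h2, sub_self, norm_zero, zero_mul]
    exact norm_nonneg _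

end Dilation

end MeasureTheory

namespace TwoScale

noncomputable section

/-! ### Completeness of `V` -/

/-- Each side of the weak-gradient identity is, up to sign, the inner product with a fixed `L²`
field, hence continuous in the pair. Closedness makes `V` complete, as the convergence of `V`-valued
mollifications requires. -/
lemma isClosed_H1per (𝕜 : Type*) [RCLike 𝕜] (d n : ℕ) :
    IsClosed (H1per 𝕜 d n : Set (PairL2 𝕜 d n)) := by
  have hcont : ∀ (ι : Type) [Fintype ι] (θ : Space d → ℝ) (_ : Continuous θ) (i : ι),
      Continuous fun v : L2Q 𝕜 d ι => ∫ y in cell d, θ y • v y i := by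
    classical
    intro ι _ θ hθ i
    have hm : MemLp (fun y => EuclideanSpace.single i ((θ y : ℝ) : 𝕜)) 2 (cellMeasure d) := by
      have hc : Continuous fun y => (EuclideanSpace.single i ((θ y : ℝ) : 𝕜)) := by
        refine (PiLp.continuous_toLp 2 _).comp (continuous_pi fun k => ?_)
        by_cases hk : k = i
        · subst hk; simpa [Function.comp_def] using RCLike.continuous_ofReal.comp hθ
        · simpa [hk] using continuous_const
      obtain ⟨C, hC⟩ := (isCompact_cell d).exists_bound_of_continuousOn hc.continuousOn
      refine MemLp.of_bound hc.aestronglyMeasurable C ?_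
      exact (ae_restrict_iff' (isCompact_cell d).measurableSet).2
        (Eventually.of_forall fun y hy => hC y hy)
    have e : (fun v : L2Q 𝕜 d ι => ∫ y in cell d, θ y • v y i) =
        fun v => inner 𝕜 (hm.toLp _) v := by
      ext v
      rw [L2.inner_def]
      refine integral_congr_ae ?_
      filter_upwards [hm.coeFn_toLp] with y hy
      rw [hy, EuclideanSpace.inner_single_left, RCLike.conj_ofReal, RCLike.real_smul_eq_coe_mul]
    rw [e]
    exact continuous_const.inner continuous_id
  have e : (H1per 𝕜 d n : Set (PairL2 𝕜 d n)) =
      ⋂ (θ : Space d → ℝ) (_ : IsPeriodicTest θ) (i : Fin n) (j : Fin d),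
        {p | ∫ y in cell d, fderiv ℝ θ y (EuclideanSpace.single j 1) • p.fst y i =
          - ∫ y in cell d, θ y • p.snd y (i, j)} := by
    ext p
    simp only [Set.mem_iInter]
    rfl
  rw [e]
  refine isClosed_iInter fun θ => isClosed_iInter fun hθ => isClosed_iInter fun i =>
    isClosed_iInter fun j => isClosed_eq ?_ ?_
  · exact (hcont _ _ (continuous_fderiv_apply hθ.1 _) i).comp
      (WithLp.fstL 2 𝕜 (L2Q 𝕜 d (Fin n)) (L2Q 𝕜 d (Fin n × Fin d))).continuous
  · exact ((hcont _ _ hθ.1.continuous (i, j)).comp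
      (WithLp.sndL 2 𝕜 (L2Q 𝕜 d (Fin n)) (L2Q 𝕜 d (Fin n × Fin d))).continuous).neg

namespace Coefficients

variable {d n : ℕ} (c : Coefficients d n) {𝕜 : Type*} [RCLike 𝕜]

lemma isClosed_V : IsClosed (c.submoduleV 𝕜 : Set (PairL2 𝕜 d n)) := by
  have e : (c.submoduleV 𝕜 : Set (PairL2 𝕜 d n)) =
      (H1per 𝕜 d n : Set (PairL2 𝕜 d n)) ∩ {p | c.mulA1 𝕜 p.snd = 0} := rfl
  rw [e]
  exact (isClosed_H1per 𝕜 d n).inter (isClosed_eq ((c.mulA1 𝕜).continuous.comp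
    (WithLp.sndL 2 𝕜 (L2Q 𝕜 d (Fin n)) (L2Q 𝕜 d (Fin n × Fin d))).continuous) continuous_const)

instance : CompleteSpace (c.V 𝕜) :=
  have : CompleteSpace (c.submoduleV 𝕜) := c.isClosed_V.completeSpace_coe
  inferInstanceAs (@CompleteSpace (c.submoduleV 𝕜) _)

/-! ### `T` as a first-order operator with constant operator coefficients -/

variable (𝕜) in
/-- The operator `V → W` dual to the `j`-th column of `(a^{(1)})^{1/2}`, so that formally
`T u = ∑ j, ∂_j (fluxCoef j u)`. -/
def fluxCoef (j : Fin d) : c.V 𝕜 →L[𝕜] c.W 𝕜 :=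
  (ContinuousLinearMap.adjoint (c.sqrtCol 𝕜 j)).comp (c.val 𝕜)

lemma inner_fluxCoef (j : Fin d) (w : c.W 𝕜) (v : c.V 𝕜) :
    inner 𝕜 w (c.fluxCoef 𝕜 j v) = inner 𝕜 (c.sqrtCol 𝕜 j w) (c.val 𝕜 v) := by
  rw [fluxCoef, ContinuousLinearMap.comp_apply, ContinuousLinearMap.adjoint_inner_right]

lemma divx_eq {Ψ : Space d → c.W 𝕜} {x : Space d} (h : DifferentiableAt ℝ Ψ x) :
    c.divx Ψ x = ∑ j, c.sqrtCol 𝕜 j (fderiv ℝ Ψ x (EuclideanSpace.single j 1)) := by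
  refine Finset.sum_congr rfl fun j _ => ?_
  have := (((c.sqrtCol 𝕜 j).restrictScalars ℝ).hasFDerivAt.comp x h.hasFDerivAt).fderiv
  exact congrArg (fun L : Space d →L[ℝ] L2Q 𝕜 d (Fin n) => L (EuclideanSpace.single j 1)) this

/-- The flux `∑ j, ∂_j (fluxCoef j φ)` of a smooth function `φ`. -/
def smoothFlux (φ : Space d → c.V 𝕜) (x : Space d) : c.W 𝕜 :=
  ∑ j, c.fluxCoef 𝕜 j (fderiv ℝ φ x (EuclideanSpace.single j 1))

/-- The identity linking `u` and its flux `ξ` on the whole space. -/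
def IsGlobalFlux (u : Space d → c.V 𝕜) (ξ : Space d → c.W 𝕜) : Prop :=
  ∀ Ψ : Space d → c.W 𝕜, ContDiff ℝ ∞ Ψ → HasCompactSupport Ψ →
    ∫ x, inner 𝕜 (Ψ x) (ξ x) = - ∫ x, inner 𝕜 (c.divx Ψ x) (c.val 𝕜 (u x))

lemma inner_real_smul_left {E : Type*} [NormedAddCommGroup E] [InnerProductSpace 𝕜 E]
    [NormedSpace ℝ E] [IsScalarTower ℝ 𝕜 E] (r : ℝ) (x y : E) :
    inner 𝕜 (r • x) y = inner 𝕜 x (r • y) := by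
  rw [RCLike.real_smul_eq_coe_smul (K := 𝕜), RCLike.real_smul_eq_coe_smul (K := 𝕜),
    inner_smul_left, inner_smul_right, RCLike.conj_ofReal]

lemma inner_real_smul_right {E : Type*} [NormedAddCommGroup E] [InnerProductSpace 𝕜 E]
    [NormedSpace ℝ E] [IsScalarTower ℝ 𝕜 E] (r : ℝ) (x y : E) :
    inner 𝕜 x (r • y) = (r : 𝕜) * inner 𝕜 x y := by
  rw [RCLike.real_smul_eq_coe_smul (K := 𝕜), inner_smul_right]

lemma continuous_smoothFlux {φ : Space d → c.V 𝕜} (h : ContDiff ℝ ∞ φ) :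
    Continuous (c.smoothFlux φ) :=
  continuous_finsetSum _ fun j _ => (c.fluxCoef 𝕜 j).continuous.comp
    ((h.continuous_fderiv (by simp)).clm_apply continuous_const)

lemma smoothFlux_eq_zero {φ : Space d → c.V 𝕜} {x : Space d} (hx : x ∉ tsupport φ) :
    c.smoothFlux φ x = 0 := by
  refine Finset.sum_eq_zero fun j _ => ?_
  rw [fderiv_of_notMem_tsupport (𝕜 := ℝ) hx]
  exact (c.fluxCoef 𝕜 j).map_zero

lemma hasCompactSupport_smoothFlux {φ : Space d → c.V 𝕜} (hc : HasCompactSupport φ) :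
    HasCompactSupport (c.smoothFlux φ) :=
  HasCompactSupport.intro hc.isCompact fun _ hx => c.smoothFlux_eq_zero hx

/-- By the product rule and the adjoint relation, the sum of the two integrands is the divergence of
the compactly supported field with components `⟨Ψ, B_j φ⟩`, whose integral is zero. -/
lemma isGlobalFlux_smoothFlux {φ : Space d → c.V 𝕜} (h : ContDiff ℝ ∞ φ)
    (hc : HasCompactSupport φ) : c.IsGlobalFlux φ (c.smoothFlux φ) := by
  intro Ψ hΨ hΨc
  have hd : ∀ x, DifferentiableAt ℝ φ x := fun x => h.differentiable (by simp) x
  have hdΨ : ∀ x, DifferentiableAt ℝ Ψ x := fun x => hΨ.differentiable (by simp) x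
  have hB : ∀ j, ContDiff ℝ ∞ fun x => c.fluxCoef 𝕜 j (φ x) := fun j =>
    ((c.fluxCoef 𝕜 j).restrictScalars ℝ).contDiff.comp h
  have hBf : ∀ j x v, fderiv ℝ (fun x => c.fluxCoef 𝕜 j (φ x)) x v =
      c.fluxCoef 𝕜 j (fderiv ℝ φ x v) := fun j x v => by
    have := (((c.fluxCoef 𝕜 j).restrictScalars ℝ).hasFDerivAt.comp x (hd x).hasFDerivAt).fderiv
    exact congrArg (fun L : Space d →L[ℝ] c.W 𝕜 => L v) this
  have hF : ∀ j, ContDiff ℝ ∞ fun x => inner 𝕜 (Ψ x) (c.fluxCoef 𝕜 j (φ x)) := fun j =>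
    hΨ.inner 𝕜 (hB j)
  have hFc : ∀ j, HasCompactSupport fun x => inner 𝕜 (Ψ x) (c.fluxCoef 𝕜 j (φ x)) := fun j =>
    HasCompactSupport.intro hΨc.isCompact fun x hx => by
      rw [image_eq_zero_of_notMem_tsupport hx, inner_zero_left]
  have hFd : ∀ j, Integrable fun x => fderiv ℝ (fun x => inner 𝕜 (Ψ x) (c.fluxCoef 𝕜 j (φ x))) x
      (EuclideanSpace.single j 1) := fun j =>
    (((hF j).continuous_fderiv (by simp)).clm_apply continuous_const).integrable_of_hasCompactSupport
      ((hFc j).fderiv_apply ℝ _)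
  have hzero : ∀ j, ∫ x, fderiv ℝ (fun x => inner 𝕜 (Ψ x) (c.fluxCoef 𝕜 j (φ x))) x
      (EuclideanSpace.single j 1) = 0 := fun j => by
    -- Integration by parts against the constant `1`.
    have := integral_smul_fderiv_eq_neg_fderiv_smul_of_integrable (μ := (volume : Measure (Space d)))
      (f := fun _ => (1 : ℝ))
      (g := fun x => inner 𝕜 (Ψ x) (c.fluxCoef 𝕜 j (φ x))) (v := EuclideanSpace.single j 1)
      (by simp) (by simpa using hFd j)
      (by simpa using (hF j).continuous.integrable_of_hasCompactSupport (hFc j))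
      (fun x _ => by fun_prop) (fun x _ => (hF j).differentiable (by simp) x)
    simpa using this
  have hpt : ∀ x, inner 𝕜 (Ψ x) (c.smoothFlux φ x) + inner 𝕜 (c.divx Ψ x) (c.val 𝕜 (φ x)) =
      ∑ j, fderiv ℝ (fun x => inner 𝕜 (Ψ x) (c.fluxCoef 𝕜 j (φ x))) x
        (EuclideanSpace.single j 1) := fun x => by
    rw [c.divx_eq (hdΨ x), smoothFlux, inner_sum, sum_inner, ← Finset.sum_add_distrib]
    refine Finset.sum_congr rfl fun j _ => ?_
    rw [fderiv_inner_apply 𝕜 (hdΨ x) ((hB j).differentiable (by simp) x), hBf, inner_fluxCoef,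
      inner_fluxCoef]
  rw [← add_eq_zero_iff_eq_neg, ← integral_add]
  · simp_rw [hpt]
    rw [integral_finsetSum _ fun j _ => hFd j]
    exact Finset.sum_eq_zero fun j _ => hzero j
  · exact (hΨ.continuous.inner (c.continuous_smoothFlux h)).integrable_of_hasCompactSupport
      (HasCompactSupport.intro hΨc.isCompact fun x hx => by
        rw [image_eq_zero_of_notMem_tsupport hx, inner_zero_left])
  · exact ((c.continuous_divx hΨ).inner ((c.val 𝕜).continuous.comp
      h.continuous)).integrable_of_hasCompactSupport
      (HasCompactSupport.intro hc.isCompact fun x hx => by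
        rw [image_eq_zero_of_notMem_tsupport hx, map_zero, inner_zero_right])

/-! ### Extension by zero, cut-off, dilation and mollification of fluxes -/

variable {c}

/-- The extension by zero of a function with a flux has the extended flux. -/
lemma IsFlux.isGlobalFlux_indicator {Ω : Set (Space d)} (hΩ : MeasurableSet Ω) {u : c.L2V 𝕜 Ω}
    {ξ : c.L2W 𝕜 Ω} (h : c.IsFlux Ω u ξ) : c.IsGlobalFlux (Ω.indicator u) (Ω.indicator ξ) := by
  intro Ψ hΨ hΨc
  -- Admissible because `Ψ` is not required to vanish on `∂Ω`; this is what excludes a boundary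
  -- term.
  have := h Ψ hΨ hΨc
  rw [← integral_indicator hΩ, ← integral_indicator hΩ] at this
  refine Eq.trans (integral_congr_ae (Eventually.of_forall fun x => ?_)) (this.trans
    (congrArg Neg.neg (integral_congr_ae (Eventually.of_forall fun x => ?_))))
  · by_cases hx : x ∈ Ω <;> simp [hx]
  · by_cases hx : x ∈ Ω <;> simp [hx]

variable (c) in
/-- The commutator `∑ j, ∂_j χ · fluxCoef j u` of `T` with the multiplication by `χ`. -/
def cutoffFlux (χ : Space d → ℝ) (u : Space d → c.V 𝕜) (x : Space d) : c.W 𝕜 :=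
  ∑ j, fderiv ℝ χ x (EuclideanSpace.single j 1) • c.fluxCoef 𝕜 j (u x)

variable (c) in
/-- The contraction `∑ j, ∂_j χ · sqrtCol j Ψ`. -/
def cutoffCol (χ : Space d → ℝ) (Ψ : Space d → c.W 𝕜) (x : Space d) : L2Q 𝕜 d (Fin n) :=
  ∑ j, fderiv ℝ χ x (EuclideanSpace.single j 1) • c.sqrtCol 𝕜 j (Ψ x)

lemma inner_cutoffFlux (χ : Space d → ℝ) (Ψ : Space d → c.W 𝕜) (u : Space d → c.V 𝕜)
    (x : Space d) :
    inner 𝕜 (Ψ x) (c.cutoffFlux χ u x) = inner 𝕜 (c.cutoffCol χ Ψ x) (c.val 𝕜 (u x)) := by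
  rw [cutoffFlux, cutoffCol, inner_sum, sum_inner]
  refine Finset.sum_congr rfl fun j _ => ?_
  rw [← inner_real_smul_left, inner_fluxCoef, ContinuousLinearMap.map_smul_of_tower]

/-- Product rule. By `inner_cutoffFlux` the second term is dual to the commutator `cutoffFlux`. -/
lemma divx_smul {χ : Space d → ℝ} (hχ : ContDiff ℝ ∞ χ) {Ψ : Space d → c.W 𝕜}
    (hΨ : ContDiff ℝ ∞ Ψ) (x : Space d) :
    c.divx (fun x => χ x • Ψ x) x = χ x • c.divx Ψ x + c.cutoffCol χ Ψ x := by
  have hdΨ : DifferentiableAt ℝ Ψ x := hΨ.differentiable (by simp) x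
  have hdχ : DifferentiableAt ℝ χ x := hχ.differentiable (by simp) x
  rw [c.divx_eq (hdχ.fun_smul hdΨ), c.divx_eq hdΨ, cutoffCol, Finset.smul_sum,
    ← Finset.sum_add_distrib]
  refine Finset.sum_congr rfl fun j _ => ?_
  have e : fderiv ℝ (fun x => χ x • Ψ x) x (EuclideanSpace.single j 1) =
      χ x • fderiv ℝ Ψ x (EuclideanSpace.single j 1) +
        fderiv ℝ χ x (EuclideanSpace.single j 1) • Ψ x := by
    rw [fderiv_fun_smul hdχ hdΨ]
    rfl
  rw [e, map_add, ContinuousLinearMap.map_smul_of_tower, ContinuousLinearMap.map_smul_of_tower]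

lemma continuous_cutoffCol {χ : Space d → ℝ} (hχ : ContDiff ℝ ∞ χ) {Ψ : Space d → c.W 𝕜}
    (hΨ : Continuous Ψ) : Continuous (c.cutoffCol χ Ψ) :=
  continuous_finsetSum _ fun j _ =>
    (continuous_fderiv_apply hχ _).smul ((c.sqrtCol 𝕜 j).continuous.comp hΨ)

lemma hasCompactSupport_cutoffCol {χ : Space d → ℝ} {Ψ : Space d → c.W 𝕜}
    (hΨ : HasCompactSupport Ψ) : HasCompactSupport (c.cutoffCol χ Ψ) :=
  HasCompactSupport.intro hΨ.isCompact fun x hx => Finset.sum_eq_zero fun j _ => by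
    rw [image_eq_zero_of_notMem_tsupport hx, map_zero, smul_zero]

/-- The product of `u` with a smooth function `χ` has the flux `χ ξ + cutoffFlux χ u`. -/
lemma IsGlobalFlux.smul_cutoff {u : Space d → c.V 𝕜} {ξ : Space d → c.W 𝕜}
    (hu : MemLp u 2) (hξ : MemLp ξ 2) (h : c.IsGlobalFlux u ξ) {χ : Space d → ℝ}
    (hχ : ContDiff ℝ ∞ χ) :
    c.IsGlobalFlux (fun x => χ x • u x) (fun x => χ x • ξ x + c.cutoffFlux χ u x) := by
  intro Ψ hΨ hΨc
  have hΨ' : ContDiff ℝ ∞ (fun x => χ x • Ψ x) := hχ.smul hΨ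
  have hΨc' : HasCompactSupport (fun x => χ x • Ψ x) :=
    HasCompactSupport.intro hΨc.isCompact fun x hx => by
      rw [image_eq_zero_of_notMem_tsupport hx, smul_zero]
  have hvu : MemLp (fun x => c.val 𝕜 (u x)) 2 := (c.val 𝕜).comp_memLp' hu
  have hKi : Integrable fun x => inner 𝕜 (c.cutoffCol χ Ψ x) (c.val 𝕜 (u x)) :=
    integrable_inner_of_memLp ((continuous_cutoffCol hχ hΨ.continuous).memLp_of_hasCompactSupport
      (hasCompactSupport_cutoffCol hΨc)) hvu
  have hξi : Integrable fun x => inner 𝕜 (χ x • Ψ x) (ξ x) :=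
    integrable_inner_of_memLp (hΨ'.continuous.memLp_of_hasCompactSupport hΨc') hξ
  have hui : Integrable fun x => inner 𝕜 (χ x • c.divx Ψ x) (c.val 𝕜 (u x)) :=
    integrable_inner_of_memLp ((hχ.continuous.smul (c.continuous_divx hΨ)).memLp_of_hasCompactSupport
      (HasCompactSupport.intro (c.hasCompactSupport_divx hΨc).isCompact fun x hx => by
        rw [Pi.smul_apply', image_eq_zero_of_notMem_tsupport hx, smul_zero])) hvu
  have e1 : ∀ x, inner 𝕜 (Ψ x) (χ x • ξ x + c.cutoffFlux χ u x) =
      inner 𝕜 (χ x • Ψ x) (ξ x) + inner 𝕜 (c.cutoffCol χ Ψ x) (c.val 𝕜 (u x)) := fun x => by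
    rw [inner_add_right, inner_real_smul_left, inner_cutoffFlux]
  -- The identity for `u` is tested with `χ Ψ`, which moves `χ` onto `u` and `ξ`.
  have e3 := h _ hΨ' hΨc'
  simp_rw [divx_smul hχ hΨ, inner_add_left] at e3
  rw [integral_add hui hKi] at e3
  simp_rw [e1]
  rw [integral_add hξi hKi, e3, neg_add, neg_add_cancel_right]
  refine congrArg Neg.neg (integral_congr_ae (Eventually.of_forall fun x => ?_))
  dsimp only
  rw [inner_real_smul_left, ContinuousLinearMap.map_smul_of_tower]

/-- Dilations. -/
lemma IsGlobalFlux.dilation {u : Space d → c.V 𝕜} {ξ : Space d → c.W 𝕜}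
    (h : c.IsGlobalFlux u ξ) (x₀ : Space d) {s : ℝ} (hs : 0 < s) :
    c.IsGlobalFlux (fun x => u (x₀ + s • (x - x₀))) (fun x => s • ξ (x₀ + s • (x - x₀))) := by
  intro Ψ hΨ hΨc
  have inv : ∀ x : Space d, x₀ + s⁻¹ • (x₀ + s • (x - x₀) - x₀) = x := fun x => by
    rw [add_sub_cancel_left, inv_smul_smul₀ hs.ne', add_sub_cancel]
  have hτ : ContDiff ℝ ∞ fun x : Space d => x₀ + s⁻¹ • (x - x₀) := by fun_prop
  -- The test function is transported by the inverse dilation. The Jacobian is common to both sides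
  -- and cancels; the chain rule contributes `s⁻¹`, which the factor `s` in the new flux
  -- compensates.
  set Ψ' : Space d → c.W 𝕜 := fun x => Ψ (x₀ + s⁻¹ • (x - x₀)) with hΨ'
  have hΨ's : ContDiff ℝ ∞ Ψ' := hΨ.comp hτ
  have hΨ'c : HasCompactSupport Ψ' := by
    refine HasCompactSupport.intro (K := (fun x => x₀ + s • (x - x₀)) '' tsupport Ψ)
      (hΨc.isCompact.image (by fun_prop)) fun x hx => ?_
    refine image_eq_zero_of_notMem_tsupport (f := Ψ) fun hmem => hx ⟨_, hmem, ?_⟩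
    dsimp only
    rw [add_sub_cancel_left, smul_inv_smul₀ hs.ne', add_sub_cancel]
  have hdiv : ∀ x, c.divx Ψ' (x₀ + s • (x - x₀)) = s⁻¹ • c.divx Ψ x := fun x => by
    have hd : DifferentiableAt ℝ Ψ x := hΨ.differentiable (by simp) x
    rw [c.divx_eq (hΨ's.differentiable (by simp) _), c.divx_eq hd, Finset.smul_sum]
    refine Finset.sum_congr rfl fun j _ => ?_
    have h1 : HasFDerivAt (fun x : Space d => x₀ + s⁻¹ • (x - x₀))
        (s⁻¹ • ContinuousLinearMap.id ℝ (Space d)) (x₀ + s • (x - x₀)) :=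
      (((hasFDerivAt_id _).sub_const x₀).const_smul s⁻¹).const_add x₀
    have h2 : HasFDerivAt Ψ (fderiv ℝ Ψ x) (x₀ + s⁻¹ • (x₀ + s • (x - x₀) - x₀)) := by
      rw [inv]; exact hd.hasFDerivAt
    have h3 : fderiv ℝ Ψ' (x₀ + s • (x - x₀)) = _ :=
      (HasFDerivAt.comp (x₀ + s • (x - x₀)) h2 h1).fderiv
    rw [h3]
    simp [ContinuousLinearMap.map_smul_of_tower]
  have e := h Ψ' hΨ's hΨ'c
  have c1 := integral_comp_add_smul_sub (μ := (volume : Measure (Space d))) x₀ hs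
    (fun x => inner 𝕜 (Ψ' x) (ξ x))
  have c2 := integral_comp_add_smul_sub (μ := (volume : Measure (Space d))) x₀ hs
    (fun x => inner 𝕜 (c.divx Ψ' x) (c.val 𝕜 (u x)))
  rw [e, smul_neg, ← c2] at c1
  simp_rw [hdiv, inner_real_smul_left, inner_real_smul_right, integral_const_mul] at c1
  simp_rw [inner_real_smul_right, integral_const_mul]
  have hΨeq : ∀ x, Ψ' (x₀ + s • (x - x₀)) = Ψ x := fun x => by rw [hΨ']; dsimp only; rw [inv]
  simp_rw [hΨeq] at c1
  rw [c1, mul_neg, ← mul_assoc, RCLike.ofReal_inv, mul_inv_cancel₀, one_mul]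
  exact_mod_cast hs.ne'

/-- Mollification. -/
lemma IsGlobalFlux.smoothFlux_convolution {u : Space d → c.V 𝕜} {ξ : Space d → c.W 𝕜}
    (hu : MemLp u 2) (hξ : MemLp ξ 2) (h : c.IsGlobalFlux u ξ) {η : Space d → ℝ}
    (hη : ContDiff ℝ ∞ η) (hηc : HasCompactSupport η) :
    c.smoothFlux (η ⋆[ContinuousLinearMap.lsmul ℝ ℝ] u) =
      η ⋆[ContinuousLinearMap.lsmul ℝ ℝ] ξ := by
  ext x
  have hul : LocallyIntegrable u := hu.locallyIntegrable (by norm_num)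
  have hξl : LocallyIntegrable ξ := hξ.locallyIntegrable (by norm_num)
  have hder : ∀ j : Fin d, fderiv ℝ (η ⋆[ContinuousLinearMap.lsmul ℝ ℝ] u) x
      (EuclideanSpace.single j 1) =
      ((fun y => fderiv ℝ η y (EuclideanSpace.single j 1)) ⋆[ContinuousLinearMap.lsmul ℝ ℝ] u) x :=
    fun j => by
      rw [(hηc.hasFDerivAt_convolution_left (ContinuousLinearMap.lsmul ℝ ℝ)
        (hη.of_le (by simp)) hul x).fderiv]
      have := (hηc.fderiv ℝ).convolutionExists_left
        ((ContinuousLinearMap.lsmul ℝ ℝ : ℝ →L[ℝ] c.V 𝕜 →L[ℝ] c.V 𝕜).precompL (Space d))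
        (hη.continuous_fderiv (by simp)) hul x
      simp_rw [convolution_def, ContinuousLinearMap.integral_apply this]
      rfl
  refine ext_inner_left 𝕜 fun w => ?_
  -- With this test function the flux integral becomes the mollified flux at `x`, paired with `w`.
  -- Differentiating `η (x - y)` in `y` yields a minus sign that cancels the one in the flux
  -- identity.
  set Ψ : Space d → c.W 𝕜 := fun y => η (x - y) • w with hΨ
  have hηx : ContDiff ℝ ∞ fun y => η (x - y) := hη.comp (contDiff_const.sub contDiff_id)
  have hηxc : HasCompactSupport fun y => η (x - y) :=
    hηc.comp_homeomorph (Homeomorph.subLeft x)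
  have hΨs : ContDiff ℝ ∞ Ψ := hηx.smul contDiff_const
  have hΨc : HasCompactSupport Ψ := hηxc.smul_right
  have hdiv : ∀ y, c.divx Ψ y =
      - ∑ j, fderiv ℝ η (x - y) (EuclideanSpace.single j 1) • c.sqrtCol 𝕜 j w := fun y => by
    rw [c.divx_eq (hΨs.differentiable (by simp) y), ← Finset.sum_neg_distrib]
    refine Finset.sum_congr rfl fun j _ => ?_
    have h1 : HasFDerivAt (fun y => η (x - y))
        ((fderiv ℝ η (x - y)).comp (-ContinuousLinearMap.id ℝ (Space d))) y :=
      HasFDerivAt.comp y (hη.differentiable (by simp) (x - y)).hasFDerivAt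
        ((hasFDerivAt_id y).const_sub x)
    rw [(h1.smul_const w).fderiv]
    simp [ContinuousLinearMap.map_smul_of_tower]
  have hi : ∀ j : Fin d, Integrable fun y =>
      fderiv ℝ η (x - y) (EuclideanSpace.single j 1) • u y := fun j =>
    ((hηc.fderiv_apply ℝ _).convolutionExists_left (ContinuousLinearMap.lsmul ℝ ℝ)
      (continuous_fderiv_apply hη _) hul x).integrable_swap
  have hi' : Integrable fun y => η (x - y) • ξ y :=
    (hηc.convolutionExists_left (ContinuousLinearMap.lsmul ℝ ℝ) hη.continuous hξl x).integrable_swap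
  have key := h Ψ hΨs hΨc
  simp_rw [hdiv, inner_neg_left, integral_neg, neg_neg, sum_inner, inner_real_smul_left] at key
  have e1 : inner 𝕜 w ((η ⋆[ContinuousLinearMap.lsmul ℝ ℝ] ξ) x) =
      ∫ y, inner 𝕜 w (η (x - y) • ξ y) := by
    rw [convolution_eq_swap]
    exact (integral_inner hi' w).symm
  have hi2 : ∀ j : Fin d, Integrable fun y => inner 𝕜 (c.sqrtCol 𝕜 j w)
      (fderiv ℝ η (x - y) (EuclideanSpace.single j 1) • c.val 𝕜 (u y)) := fun j => by
    have := ((c.val 𝕜).integrable_comp (hi j)).const_inner (𝕜 := 𝕜) (c.sqrtCol 𝕜 j w)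
    simpa only [ContinuousLinearMap.map_smul_of_tower] using this
  have e0 : ∫ y, inner 𝕜 w (η (x - y) • ξ y) = ∫ y, inner 𝕜 (Ψ y) (ξ y) := by
    simp_rw [hΨ, inner_real_smul_left]
  rw [e1, e0, key, integral_finsetSum _ fun j _ => hi2 j, smoothFlux, inner_sum]
  refine Finset.sum_congr rfl fun j _ => ?_
  rw [hder, inner_fluxCoef, convolution_eq_swap]
  have := (c.val 𝕜).integral_comp_comm (hi j)
  have e2 : c.val 𝕜 (∫ y, fderiv ℝ η (x - y) (EuclideanSpace.single j 1) • u y) =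
    ∫ y, fderiv ℝ η (x - y) (EuclideanSpace.single j 1) • c.val 𝕜 (u y) := by
    rw [← this]
    simp only [ContinuousLinearMap.map_smul_of_tower]
  simp only [ContinuousLinearMap.lsmul_apply]
  rw [e2, ← integral_inner]
  have := (c.val 𝕜).integrable_comp (hi j)
  simpa only [ContinuousLinearMap.map_smul_of_tower] using this

lemma aestronglyMeasurable_cutoffFlux {χ : Space d → ℝ} (hχ : ContDiff ℝ ∞ χ)
    {u : Space d → c.V 𝕜} (hu : AEStronglyMeasurable u) :
    AEStronglyMeasurable (c.cutoffFlux χ u) :=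
  Finset.aestronglyMeasurable_fun_sum _ fun j _ =>
    (continuous_fderiv_apply hχ _).aestronglyMeasurable.smul
      ((c.fluxCoef 𝕜 j).continuous.comp_aestronglyMeasurable hu)

/-! ### The three approximation steps -/

/-- The commutators with the dilated cut-off functions `x ↦ χ (x / R)` are of order `1 / R`. -/
lemma exists_norm_cutoffFlux_le (c : Coefficients d n) {χ : Space d → ℝ} (hχ : ContDiff ℝ ∞ χ)
    (hχc : HasCompactSupport χ) : ∃ C : ℝ, 0 ≤ C ∧ ∀ R : ℝ, 0 < R → ∀ (u : Space d → c.V 𝕜) x,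
      ‖c.cutoffFlux (fun x => χ (R⁻¹ • x)) u x‖ ≤ C / R * ‖u x‖ := by
  obtain ⟨M, hM⟩ := (hχc.fderiv ℝ).exists_bound_of_continuous (hχ.continuous_fderiv (by simp))
  have hM0 : 0 ≤ M := (norm_nonneg _).trans (hM 0)
  refine ⟨∑ j, M * ‖c.fluxCoef 𝕜 j‖, Finset.sum_nonneg fun j _ => by positivity,
    fun R hR u x => ?_⟩
  have hder : fderiv ℝ (fun x => χ (R⁻¹ • x)) x = R⁻¹ • fderiv ℝ χ (R⁻¹ • x) := by
    have h1 : HasFDerivAt (fun x : Space d => R⁻¹ • x)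
        (R⁻¹ • ContinuousLinearMap.id ℝ (Space d)) x := (hasFDerivAt_id x).const_smul R⁻¹
    have h2 := (HasFDerivAt.comp x
      (hχ.differentiable (by simp) (R⁻¹ • x)).hasFDerivAt h1).fderiv
    refine h2.trans ?_
    ext v
    simp
  rw [Finset.sum_div, Finset.sum_mul]
  refine norm_sum_le_of_le _ fun j _ => ?_
  rw [norm_smul, hder]
  calc ‖(R⁻¹ • fderiv ℝ χ (R⁻¹ • x)) (EuclideanSpace.single j 1)‖ * ‖c.fluxCoef 𝕜 j (u x)‖
      ≤ (R⁻¹ * M) * (‖c.fluxCoef 𝕜 j‖ * ‖u x‖) := by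
        gcongr
        · refine (ContinuousLinearMap.le_opNorm _ _).trans ?_
          rw [norm_smul, Real.norm_of_nonneg (by positivity)]
          simp only [PiLp.norm_single, norm_one, mul_one]
          gcongr
          exact hM _
        · exact ContinuousLinearMap.le_opNorm _ _
    _ = M * ‖c.fluxCoef 𝕜 j‖ / R * ‖u x‖ := by ring

/-- Approximation by functions with bounded support. -/
lemma IsGlobalFlux.exists_bounded_support {u : Space d → c.V 𝕜} {ξ : Space d → c.W 𝕜}
    (hu : MemLp u 2) (hξ : MemLp ξ 2) (h : c.IsGlobalFlux u ξ) {ε : ℝ≥0∞} (hε : 0 < ε) :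
    ∃ (u' : Space d → c.V 𝕜) (ξ' : Space d → c.W 𝕜), MemLp u' 2 ∧ MemLp ξ' 2 ∧
      c.IsGlobalFlux u' ξ' ∧ (∃ M : ℝ, ∀ x, u' x ≠ 0 → u x ≠ 0 ∧ ‖x‖ ≤ M) ∧
      eLpNorm (u' - u) 2 ≤ ε ∧ eLpNorm (ξ' - ξ) 2 ≤ ε := by
  have hε2 : 0 < ε / 2 := ENNReal.half_pos hε.ne'
  -- Equal to `1` on the unit ball and supported in the ball of radius `2`, so `x ↦ b (x / R)`
  -- vanishes beyond radius `R * 2`.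
  let b : ContDiffBump (0 : Space d) := ⟨1, 2, one_pos, one_lt_two⟩
  have hb : ContDiff ℝ ∞ b := b.contDiff
  have hb01 : ∀ x, b x ∈ Set.Icc (0 : ℝ) 1 := fun x => ⟨b.nonneg, b.le_one⟩
  have hb1 : ∀ x, ‖x‖ ≤ 1 → b x = 1 := fun x hx =>
    b.one_of_mem_closedBall (by rwa [mem_closedBall_zero_iff])
  obtain ⟨C, hC0, hC⟩ := exists_norm_cutoffFlux_le (𝕜 := 𝕜) c hb b.hasCompactSupport
  have hlim : Tendsto (fun R : ℝ => ENNReal.ofReal (C / R) * eLpNorm u 2) atTop (𝓝 0) := by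
    have h1 : Tendsto (fun R : ℝ => C / R) atTop (𝓝 0) := tendsto_id.const_div_atTop C
    have h2 := ENNReal.Tendsto.mul_const (ENNReal.tendsto_ofReal h1)
      (Or.inr hu.eLpNorm_ne_top)
    simpa using h2
  obtain ⟨R, ⟨⟨⟨hR0, h1⟩, h2⟩, h3⟩⟩ := ((((eventually_gt_atTop (0 : ℝ)).and
    (hu.eventually_eLpNorm_cutoff_sub_le hb01 hb1 hε)).and
    (hξ.eventually_eLpNorm_cutoff_sub_le hb01 hb1 hε2)).and
    (ENNReal.tendsto_nhds_zero.1 hlim _ hε2)).exists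
  set χ : Space d → ℝ := fun x => b (R⁻¹ • x) with hχ
  have hχs : ContDiff ℝ ∞ χ := hb.comp (contDiff_const_smul _)
  have hχn : ∀ x, ‖χ x‖ ≤ 1 := fun x => by
    rw [Real.norm_of_nonneg (hb01 _).1]; exact (hb01 _).2
  have hflux : MemLp (c.cutoffFlux χ u) 2 := hu.of_le_mul
    (aestronglyMeasurable_cutoffFlux hχs hu.1) (Eventually.of_forall (hC R hR0 u))
  have hχξ : MemLp (fun x => χ x • ξ x) 2 := hξ.of_le
    (hχs.continuous.aestronglyMeasurable.smul hξ.1) (Eventually.of_forall fun x => by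
      rw [norm_smul]; exact mul_le_of_le_one_left (norm_nonneg _) (hχn x))
  have hχu : MemLp (fun x => χ x • u x) 2 := hu.of_le
    (hχs.continuous.aestronglyMeasurable.smul hu.1) (Eventually.of_forall fun x => by
      rw [norm_smul]; exact mul_le_of_le_one_left (norm_nonneg _) (hχn x))
  refine ⟨fun x => χ x • u x, fun x => χ x • ξ x + c.cutoffFlux χ u x, hχu, hχξ.add hflux,
    h.smul_cutoff hu hξ hχs, ⟨R * 2, fun x hx => ?_⟩, h1, ?_⟩
  · refine ⟨fun h0 => hx (by dsimp only; rw [h0, smul_zero]), ?_⟩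
    have hx' : b (R⁻¹ • x) ≠ 0 := fun h0 => hx (by
      have : χ x = 0 := h0
      dsimp only; rw [this, zero_smul])
    have : R⁻¹ • x ∈ Metric.ball (0 : Space d) 2 := by
      rw [← Function.mem_support, b.support_eq] at hx'
      exact hx'
    rw [mem_ball_zero_iff, norm_smul, Real.norm_of_nonneg (by positivity),
      inv_mul_lt_iff₀ hR0] at this
    exact this.le
  · have e : (fun x => χ x • ξ x + c.cutoffFlux χ u x) - ξ =
        (fun x => χ x • ξ x - ξ x) + c.cutoffFlux χ u := by
      ext x
      simp only [Pi.sub_apply, Pi.add_apply]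
      abel
    rw [e, ← ENNReal.add_halves ε]
    refine (eLpNorm_add_le (hχξ.1.sub hξ.1) hflux.1 (by norm_num)).trans (add_le_add h2 ?_)
    refine le_trans ?_ h3
    exact eLpNorm_le_mul_eLpNorm_of_ae_le_mul (Eventually.of_forall (hC R hR0 u)) 2

/-- Approximation by dilations. -/
lemma IsGlobalFlux.exists_dilation {u : Space d → c.V 𝕜} {ξ : Space d → c.W 𝕜}
    (hu : MemLp u 2) (hξ : MemLp ξ 2) (h : c.IsGlobalFlux u ξ) (x₀ : Space d) {ε : ℝ≥0∞}
    (hε : 0 < ε) :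
    ∃ (s : ℝ) (ξ' : Space d → c.W 𝕜), 1 < s ∧ MemLp (fun x => u (x₀ + s • (x - x₀))) 2 ∧
      MemLp ξ' 2 ∧ c.IsGlobalFlux (fun x => u (x₀ + s • (x - x₀))) ξ' ∧
      eLpNorm ((fun x => u (x₀ + s • (x - x₀))) - u) 2 ≤ ε ∧ eLpNorm (ξ' - ξ) 2 ≤ ε := by
  have hε2 : 0 < ε / 2 := ENNReal.half_pos hε.ne'
  -- The dilated flux carries the factor `s`. With `s < 2`, an error of `ε / 4` before
  -- multiplication costs at most `ε / 2`; the other half pays for `(s - 1) ξ`.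
  have hε4 : 0 < ε / 2 / 2 := ENNReal.half_pos hε2.ne'
  have hlim : Tendsto (fun s : ℝ => ENNReal.ofReal (s - 1) * eLpNorm ξ 2) (𝓝[>] 1) (𝓝 0) := by
    have h1 : Tendsto (fun s : ℝ => s - 1) (𝓝 1) (𝓝 (1 - 1)) :=
      (Continuous.tendsto (by fun_prop) 1)
    have h2 := ENNReal.Tendsto.mul_const (ENNReal.tendsto_ofReal h1)
      (Or.inr hξ.eLpNorm_ne_top)
    simp only [sub_self, ENNReal.ofReal_zero, zero_mul] at h2
    exact h2.mono_left nhdsWithin_le_nhds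
  have h2s : ∀ᶠ s : ℝ in 𝓝[>] 1, s < 2 :=
    (eventually_lt_nhds (by norm_num : (1 : ℝ) < 2)).filter_mono nhdsWithin_le_nhds
  have h1s : ∀ᶠ s : ℝ in 𝓝[>] 1, 1 < s := self_mem_nhdsWithin
  obtain ⟨s, ⟨⟨⟨hs1, hs2⟩, h1⟩, h2⟩, h3⟩ := ((((h1s.and h2s).and
    (hu.eventually_eLpNorm_dilation_sub_le x₀ hε)).and
    (hξ.eventually_eLpNorm_dilation_sub_le x₀ hε4)).and
    (ENNReal.tendsto_nhds_zero.1 hlim _ hε2)).exists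
  have hs0 : 0 < s := by linarith
  have hξs := hξ.comp_add_smul_sub x₀ hs0
  refine ⟨s, fun x => s • ξ (x₀ + s • (x - x₀)), hs1, hu.comp_add_smul_sub x₀ hs0,
    hξs.const_smul s, h.dilation x₀ hs0, h1, ?_⟩
  have e : (fun x => s • ξ (x₀ + s • (x - x₀))) - ξ =
      s • (fun x => ξ (x₀ + s • (x - x₀)) - ξ x) + (s - 1) • ξ := by
    ext x
    simp only [Pi.sub_apply, Pi.add_apply, Pi.smul_apply, smul_sub, sub_smul, one_smul]
    abel
  rw [e, ← ENNReal.add_halves ε]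
  refine (eLpNorm_add_le ((hξs.1.sub hξ.1).const_smul s) (hξ.1.const_smul _)
    (by norm_num)).trans (add_le_add ?_ ?_)
  · rw [eLpNorm_const_smul, ← ENNReal.add_halves (ε / 2), ← two_mul]
    gcongr
    · rw [Real.enorm_eq_ofReal hs0.le]
      exact ENNReal.ofReal_le_of_le_toReal (by simpa using hs2.le)
    · exact h2
  · rw [eLpNorm_const_smul, Real.enorm_eq_ofReal (by linarith)]
    exact h3

/-- Approximation by smooth functions, for functions that vanish outside a compact subset of
an open set. -/
lemma IsGlobalFlux.exists_contDiff {u : Space d → c.V 𝕜} {ξ : Space d → c.W 𝕜}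
    (hu : MemLp u 2) (hξ : MemLp ξ 2) (h : c.IsGlobalFlux u ξ) {Ω K : Set (Space d)}
    (hΩ : IsOpen Ω) (hK : IsCompact K) (hKΩ : K ⊆ Ω) (huK : Function.support u ⊆ K)
    {ε : ℝ≥0∞} (hε : 0 < ε) :
    ∃ φ : Space d → c.V 𝕜, ContDiff ℝ ∞ φ ∧ HasCompactSupport φ ∧ tsupport φ ⊆ Ω ∧
      eLpNorm (φ - u) 2 ≤ ε ∧ eLpNorm (c.smoothFlux φ - ξ) 2 ≤ ε := by
  obtain ⟨δ₁, hδ₁, h1⟩ := hu.exists_eLpNorm_convolution_sub_le hε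
  obtain ⟨δ₂, hδ₂, h2⟩ := hξ.exists_eLpNorm_convolution_sub_le hε
  obtain ⟨δ₃, hδ₃, h3⟩ := hK.exists_cthickening_subset_open hΩ hKΩ
  -- The first two bounds control the errors in `u` and `ξ`; the third keeps the mollified support
  -- within the `δ₃`-thickening of `K`, inside `Ω`.
  obtain ⟨r, hr0, hr⟩ := exists_between (lt_min hδ₁ (lt_min hδ₂ hδ₃))
  simp only [lt_min_iff] at hr
  let b : ContDiffBump (0 : Space d) := ⟨r / 2, r, half_pos hr0, half_lt_self hr0⟩
  set η : Space d → ℝ := b.normed volume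
  have hη : ContDiff ℝ ∞ η := b.contDiff_normed
  have hηc : HasCompactSupport η := b.hasCompactSupport_normed
  set φ : Space d → c.V 𝕜 := η ⋆[ContinuousLinearMap.lsmul ℝ ℝ] u
  have hsupp : tsupport φ ⊆ Metric.cthickening δ₃ K := by
    refine closure_minimal (fun x hx => ?_) Metric.isClosed_cthickening
    obtain ⟨y, hy, z, hz, rfl⟩ := Set.mem_add.1 (support_convolution_subset _ hx)
    rw [b.support_normed_eq, mem_ball_zero_iff] at hy
    refine Metric.mem_cthickening_of_dist_le _ z _ _ (huK hz) ?_
    rw [dist_eq_norm, add_sub_cancel_right]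
    exact hy.le.trans hr.2.2.le
  refine ⟨φ, hηc.contDiff_convolution_left _ hη (hu.locallyIntegrable (by norm_num)),
    hK.cthickening.of_isClosed_subset (isClosed_tsupport φ) hsupp, hsupp.trans h3,
    h1 b hr.1, ?_⟩
  rw [h.smoothFlux_convolution hu hξ hη hηc]
  exact h2 b hr.2.1

/-- Approximation by test functions in a strictly star-shaped domain. -/
lemma IsGlobalFlux.exists_contDiff_of_isStrictlyStarShaped {u : Space d → c.V 𝕜}
    {ξ : Space d → c.W 𝕜} (hu : MemLp u 2) (hξ : MemLp ξ 2) (h : c.IsGlobalFlux u ξ)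
    {Ω : Set (Space d)} (hΩ : IsStrictlyStarShaped Ω) (huΩ : Function.support u ⊆ Ω)
    {ε : ℝ≥0∞} (hε : 0 < ε) :
    ∃ φ : Space d → c.V 𝕜, ContDiff ℝ ∞ φ ∧ HasCompactSupport φ ∧ tsupport φ ⊆ Ω ∧
      eLpNorm (φ - u) 2 ≤ ε ∧ eLpNorm (c.smoothFlux φ - ξ) 2 ≤ ε := by
  have hε3 : 0 < ε / 3 := ENNReal.div_pos hε.ne' (by norm_num)
  obtain ⟨hΩo, x₀, hx₀, hstar⟩ := hΩ
  obtain ⟨u₁, ξ₁, hu₁, hξ₁, hf₁, ⟨M, hM⟩, a₁, b₁⟩ := h.exists_bounded_support hu hξ hε3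
  obtain ⟨s, ξ₂, hs, hu₂, hξ₂, hf₂, a₂, b₂⟩ := hf₁.exists_dilation hu₁ hξ₁ x₀ hε3
  have hs0 : 0 < s := by linarith
  set u₂ : Space d → c.V 𝕜 := fun x => u₁ (x₀ + s • (x - x₀)) with hu₂def
  -- The closure makes `K` compact, and star-shapedness, assumed on `closure Ω` with `t = s⁻¹ < 1`,
  -- still puts `K` inside `Ω`.
  set K : Set (Space d) := (fun x => x₀ + s⁻¹ • (x - x₀)) '' (closure Ω ∩ Metric.closedBall 0 M)
    with hKdef
  have hK : IsCompact K := ((isCompact_closedBall 0 M).inter_left isClosed_closure).image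
    (by fun_prop)
  have hKΩ : K ⊆ Ω := by
    rintro _ ⟨x, hx, rfl⟩
    exact hstar x hx.1 _ ⟨by positivity, inv_lt_one_of_one_lt₀ hs⟩
  have huK : Function.support u₂ ⊆ K := by
    intro x hx
    obtain ⟨h1, h2⟩ := hM _ hx
    refine ⟨x₀ + s • (x - x₀), ⟨subset_closure (huΩ h1), mem_closedBall_zero_iff.2 h2⟩, ?_⟩
    dsimp only
    rw [add_sub_cancel_left, inv_smul_smul₀ hs0.ne', add_sub_cancel]
  obtain ⟨φ, hφ, hφc, hφΩ, a₃, b₃⟩ := hf₂.exists_contDiff hu₂ hξ₂ hΩo hK hKΩ huK hε3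
  have key : ∀ {F : Type _} [NormedAddCommGroup F] {f₀ f₁ f₂ f₃ : Space d → F},
      AEStronglyMeasurable f₀ → AEStronglyMeasurable f₁ → AEStronglyMeasurable f₂ →
      AEStronglyMeasurable f₃ → eLpNorm (f₁ - f₀) 2 ≤ ε / 3 → eLpNorm (f₂ - f₁) 2 ≤ ε / 3 →
      eLpNorm (f₃ - f₂) 2 ≤ ε / 3 → eLpNorm (f₃ - f₀) 2 ≤ ε := by
    intro F _ f₀ f₁ f₂ f₃ m₀ m₁ m₂ m₃ l₁ l₂ l₃
    have e : f₃ - f₀ = (f₃ - f₂) + (f₂ - f₁) + (f₁ - f₀) := by abel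
    rw [e, ← ENNReal.add_thirds ε]
    exact (eLpNorm_add_le ((m₃.sub m₂).add (m₂.sub m₁)) (m₁.sub m₀) (by norm_num)).trans
      (add_le_add ((eLpNorm_add_le (m₃.sub m₂) (m₂.sub m₁) (by norm_num)).trans
        (add_le_add l₃ l₂)) l₁)
  exact ⟨φ, hφ, hφc, hφΩ,
    key hu.1 hu₁.1 hu₂.1 hφ.continuous.aestronglyMeasurable a₁ a₂ a₃,
    key hξ.1 hξ₁.1 hξ₂.1 (c.continuous_smoothFlux hφ).aestronglyMeasurable b₁ b₂ b₃⟩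

/-! ### Return to `Ω` and to the norm of `U` -/

/-- A test function has its classical flux. -/
lemma isFlux_of_ae_eq_smooth {Ω : Set (Space d)} {φ : Space d → c.V 𝕜} (h : ContDiff ℝ ∞ φ)
    (hc : HasCompactSupport φ) (hs : tsupport φ ⊆ Ω) {f : c.L2V 𝕜 Ω} {ζ : c.L2W 𝕜 Ω}
    (hf : f =ᵐ[volume.restrict Ω] φ) (hζ : ζ =ᵐ[volume.restrict Ω] c.smoothFlux φ) :
    c.IsFlux Ω f ζ := by
  intro Ψ hΨ hΨc
  have e1 : ∫ x in Ω, inner 𝕜 (Ψ x) (ζ x) = ∫ x in Ω, inner 𝕜 (Ψ x) (c.smoothFlux φ x) :=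
    integral_congr_ae (hζ.mono fun x hx => by dsimp only; rw [hx])
  have e2 : ∫ x in Ω, inner 𝕜 (c.divx Ψ x) (c.val 𝕜 (f x)) =
      ∫ x in Ω, inner 𝕜 (c.divx Ψ x) (c.val 𝕜 (φ x)) :=
    integral_congr_ae (hf.mono fun x hx => by dsimp only; rw [hx])
  -- Both integrands vanish off `tsupport φ ⊆ Ω`, so integrating over `Ω` or over `ℝ^d` is the same.
  rw [e1, e2, setIntegral_eq_integral_of_forall_compl_eq_zero fun x hx => ?_,
    setIntegral_eq_integral_of_forall_compl_eq_zero fun x hx => ?_]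
  · exact c.isGlobalFlux_smoothFlux h hc Ψ hΨ hΨc
  · rw [image_eq_zero_of_notMem_tsupport fun h' => hx (hs h'), map_zero, inner_zero_right]
  · rw [c.smoothFlux_eq_zero fun h' => hx (hs h'), inner_zero_right]

lemma testFunctions_subset_U (c : Coefficients d n) (Ω : Set (Space d)) :
    c.testFunctions 𝕜 Ω ⊆ (c.U 𝕜 Ω : Set (c.L2V 𝕜 Ω)) := by
  rintro f ⟨φ, h, hc, hs, hf⟩
  have hm : MemLp (c.smoothFlux φ) 2 (volume.restrict Ω) :=
    (c.continuous_smoothFlux h).memLp_of_hasCompactSupport (c.hasCompactSupport_smoothFlux hc)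
  exact ⟨hm.toLp _, isFlux_of_ae_eq_smooth h hc hs hf hm.coeFn_toLp⟩

/-- Cauchy–Schwarz in `L²`. It bounds the `a^{(0)}` and `ρ` terms of the form by `‖u‖ ^ 2`, whatever
the sign of `a^{(0)}`. -/
lemma re_integral_inner_clm_le {E F : Type*} [NormedAddCommGroup E] [InnerProductSpace 𝕜 E]
    [NormedAddCommGroup F] [InnerProductSpace 𝕜 F] {X : Type*} [MeasurableSpace X]
    {μ : Measure X} (G : E →L[𝕜] F) (A : F →L[𝕜] F) (u : Lp E 2 μ) :
    RCLike.re (∫ x, inner 𝕜 (G (u x)) (A (G (u x))) ∂μ) ≤ ‖G‖ * ‖A.comp G‖ * ‖u‖ ^ 2 := by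
  have e : ∫ x, inner 𝕜 (G (u x)) (A (G (u x))) ∂μ =
      inner 𝕜 (G.compLp u) ((A.comp G).compLp u) := by
    rw [L2.inner_def]
    refine integral_congr_ae ?_
    filter_upwards [G.coeFn_compLp u, (A.comp G).coeFn_compLp u] with x h1 h2
    rw [h1, h2, ContinuousLinearMap.comp_apply]
  rw [e]
  calc _ ≤ ‖G.compLp u‖ * ‖(A.comp G).compLp u‖ := re_inner_le_norm _ _
    _ ≤ (‖G‖ * ‖u‖) * (‖A.comp G‖ * ‖u‖) := by
        gcongr
        · exact G.norm_compLp_le u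
        · exact (A.comp G).norm_compLp_le u
    _ = _ := by ring

/-- The norm of `U` is dominated by the graph norm of `T`. -/
lemma exists_normU_le (c : Coefficients d n) (𝕜 : Type*) [RCLike 𝕜] (Ω : Set (Space d)) :
    ∃ C : ℝ, 0 < C ∧ ∀ u : c.U 𝕜 Ω, c.normU u ≤ C * (‖u.1‖ + ‖c.T 𝕜 Ω u‖) := by
  -- The form is at most `D * (‖u‖ ^ 2 + ‖T u‖ ^ 2)`. The summand `1` gives `D ≤ D ^ 2`, so `D`
  -- itself can serve as the constant after the square root.
  set D : ℝ := 1 + ‖c.grad 𝕜‖ * ‖(c.mulA0 𝕜).comp (c.grad 𝕜)‖ +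
    ‖c.val 𝕜‖ * ‖(c.mulρ 𝕜).comp (c.val 𝕜)‖ with hD
  have h1 : 0 ≤ ‖c.grad 𝕜‖ * ‖(c.mulA0 𝕜).comp (c.grad 𝕜)‖ := by positivity
  have h2 : 0 ≤ ‖c.val 𝕜‖ * ‖(c.mulρ 𝕜).comp (c.val 𝕜)‖ := by positivity
  have hD1 : 1 ≤ D := by linarith
  refine ⟨D, by linarith, fun u => ?_⟩
  refine Real.sqrt_le_iff.2 ⟨by positivity, ?_⟩
  have eT : RCLike.re (∫ x in Ω, inner 𝕜 (c.T 𝕜 Ω u x) (c.T 𝕜 Ω u x)) = ‖c.T 𝕜 Ω u‖ ^ 2 := by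
    rw [← L2.inner_def (𝕜 := 𝕜), inner_self_eq_norm_sq]
  have eg := re_integral_inner_clm_le (c.grad 𝕜) (c.mulA0 𝕜) u.1
  have ev := re_integral_inner_clm_le (c.val 𝕜) (c.mulρ 𝕜) u.1
  rw [form, map_add, map_add, eT]
  have hsq : D ≤ D ^ 2 := by nlinarith
  nlinarith [norm_nonneg u.1, norm_nonneg (c.T 𝕜 Ω u), mul_nonneg (norm_nonneg u.1)
    (norm_nonneg (c.T 𝕜 Ω u)), sq_nonneg ‖u.1‖, sq_nonneg ‖c.T 𝕜 Ω u‖,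
    mul_nonneg (mul_nonneg (sq_nonneg D) (norm_nonneg u.1)) (norm_nonneg (c.T 𝕜 Ω u)),
    mul_nonneg (sub_nonneg.2 hsq) (sq_nonneg ‖u.1‖),
    mul_nonneg (sub_nonneg.2 hsq) (sq_nonneg ‖c.T 𝕜 Ω u‖),
    mul_nonneg (sub_nonneg.2 hD1) (sq_nonneg ‖c.T 𝕜 Ω u‖)]

end Coefficients

/-- Reduces the case `Ω = ℝ^d` to the star-shaped one. -/
lemma isStrictlyStarShaped_univ (d : ℕ) : IsStrictlyStarShaped (Set.univ : Set (Space d)) :=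
  ⟨isOpen_univ, 0, Set.mem_univ _, fun _ _ _ _ => Set.mem_univ _⟩

/-- On an element of `L²(Ω)`, the distance to the class of a function is at most the `L²(ℝ^d)`
distance of the extension by zero to this function. -/
lemma norm_sub_toLp_le {d : ℕ} {F : Type*} [NormedAddCommGroup F] {Ω : Set (Space d)}
    (hΩ : MeasurableSet Ω) (u : Lp F 2 (volume.restrict Ω)) {φ : Space d → F}
    (hφ : MemLp φ 2 (volume.restrict Ω)) {ε : ℝ} (hε : 0 ≤ ε)
    (h : eLpNorm (φ - Ω.indicator u) 2 ≤ ENNReal.ofReal ε) : ‖u - hφ.toLp φ‖ ≤ ε := by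
  rw [norm_sub_rev, Lp.norm_def]
  refine ENNReal.toReal_le_of_le_ofReal hε (le_trans (le_of_eq ?_)
    ((eLpNorm_mono_measure _ (Measure.restrict_le_self (s := Ω))).trans h))
  refine eLpNorm_congr_ae ?_
  filter_upwards [Lp.coeFn_sub (hφ.toLp φ) u, hφ.coeFn_toLp, ae_restrict_mem hΩ] with x h1 h2 h3
  rw [h1, Pi.sub_apply, Pi.sub_apply, h2, Set.indicator_of_mem h3]

end

end TwoScale

theorem mainTheorem7 {𝕜 : Type*} [RCLike 𝕜] {d n : ℕ} (hd : 2 ≤ d) (hn : 1 ≤ n)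
    (c : TwoScale.Coefficients d n) (Ω : Set (TwoScale.Space d))
    (hΩ : TwoScale.IsStrictlyStarShaped Ω ∨ Ω = Set.univ) :
    c.testFunctions 𝕜 Ω ⊆ (c.U 𝕜 Ω : Set (c.L2V 𝕜 Ω)) ∧
      ∀ u : c.U 𝕜 Ω, ∀ ε : ℝ, 0 < ε →
        ∃ φ : c.U 𝕜 Ω, φ.1 ∈ c.testFunctions 𝕜 Ω ∧ c.normU (u - φ) < ε := by
  refine ⟨c.testFunctions_subset_U Ω, fun u ε hε => ?_⟩
  have hstar : TwoScale.IsStrictlyStarShaped Ω :=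
    hΩ.elim id fun h => h ▸ TwoScale.isStrictlyStarShaped_univ d
  have hm : MeasurableSet Ω := hstar.1.measurableSet
  obtain ⟨C, hC, hnorm⟩ := c.exists_normU_le 𝕜 Ω
  -- Two errors of this size, multiplied by `C`, add up to `ε / 2`, which leaves the strict
  -- inequality.
  have hε' : 0 < ε / (4 * C) := by positivity
  obtain ⟨φ, hφ, hφc, hφΩ, h1, h2⟩ :=
    ((c.isFlux_T 𝕜 u).isGlobalFlux_indicator hm).exists_contDiff_of_isStrictlyStarShaped
      ((memLp_indicator_iff_restrict hm).2 (Lp.memLp u.1))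
      ((memLp_indicator_iff_restrict hm).2 (Lp.memLp (c.T 𝕜 Ω u))) hstar
      Set.support_indicator_subset (ENNReal.ofReal_pos.2 hε')
  have hφm : MemLp φ 2 (volume.restrict Ω) := hφ.continuous.memLp_of_hasCompactSupport hφc
  have hζm : MemLp (c.smoothFlux φ) 2 (volume.restrict Ω) :=
    (c.continuous_smoothFlux hφ).memLp_of_hasCompactSupport (c.hasCompactSupport_smoothFlux hφc)
  have hmem : hφm.toLp φ ∈ c.testFunctions 𝕜 Ω := ⟨φ, hφ, hφc, hφΩ, hφm.coeFn_toLp⟩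
  let f : c.U 𝕜 Ω := ⟨hφm.toLp φ, c.testFunctions_subset_U Ω hmem⟩
  -- `T` is defined by choice; uniqueness of the flux identifies `T f` with the classical flux of
  -- `φ`.
  have hT : c.T 𝕜 Ω f = hζm.toLp (c.smoothFlux φ) := (c.isFlux_T 𝕜 f).unique
    (TwoScale.Coefficients.isFlux_of_ae_eq_smooth hφ hφc hφΩ hφm.coeFn_toLp hζm.coeFn_toLp)
  refine ⟨f, hmem, (hnorm (u - f)).trans_lt ?_⟩
  have b1 : ‖(u - f).1‖ ≤ ε / (4 * C) := TwoScale.norm_sub_toLp_le hm u.1 hφm hε'.le h1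
  have b2 : ‖c.T 𝕜 Ω (u - f)‖ ≤ ε / (4 * C) := by
    rw [map_sub, hT]
    exact TwoScale.norm_sub_toLp_le hm _ hζm hε'.le h2
  calc C * (‖(u - f).1‖ + ‖c.T 𝕜 Ω (u - f)‖) ≤ C * (ε / (4 * C) + ε / (4 * C)) := by gcongr
    _ = ε / 2 := by field_simp; ring
    _ < ε := half_lt_self hε
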